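/- **Setting.** Let $G$ be a real semisimple Lie group with Lie algebra $\mathfrak g$ (a complex group is regarded as a real one). Let $\mathfrak p\subset\mathfrak g$ be a parabolic subalgebra, i.e. $\mathfrak p^{\perp}$ (for the Killing form) equals the nilradical $\mathfrak p_+$ of $\mathfrak p$. It defines the filtration $\mathfrak g^1=\mathfrak p_+$, $\mathfrak g^i=[\mathfrak g^{i-1},\mathfrak p_+]$ for $i\ge 2$, $\mathfrak g^{1-j}=(\mathfrak g^{j})^\perp$ for $j\ge 1$. Fix a Lie algebra grading $\mathfrak g=\bigoplus_i\mathfrak g_i$ splitting it, $\mathfrak g^i=\bigoplus_{j\ge i}\mathfrak g_j$ for all $i\in\mathbb Z$, and put $\mathfrak g_-=\bigoplus_{i<0}\mathfrak g_i$. Let $P<G$ be a Lie subgroup with Lie algebra $\mathfrak p$, and let $(\pi:B\to M,\omega)$ be a smooth Cartan geometry of type $(\mathfrak g,P)$: a smooth principal right $P$-bundle with a smooth $\omega\in\Omega^1(B,\mathfrak g)$ such that each $\omega_b:T_bB\to\mathfrak g$ is an isomorphism, $R_p^*\omega=\mathrm{Ad}(p^{-1})\omega$, and $\omega$ maps the fundamental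 vector field of $Y\in\mathfrak p$ to $Y$. Let $\tilde\eta$ be an infinitesimal automorphism of $(B,\omega)$, i.e. a smooth $P$-invariant vector field on $B$ with $\mathcal L_{\tilde\eta}\omega=0$, and let $b_0\in B$ with $Z:=\omega_{b_0}(\tilde\eta)\in\mathfrak p_+$. Let $T(Z)$ be the set of $X\in\mathfrak g_-$ such that $A=[Z,X]$ satisfies $[A,Z]=2Z$ and $[A,X]=-2X$. For $X\in\mathfrak g$ let $\tilde X$ be the vector field on $B$ with $\omega(\tilde X)\equiv X$, and let $\exp_{b_0}(X)$ be the value at time $1$ of its integral curve starting at $b_0$, when this exists. Let $\tilde\gamma_X(s)=\exp_{b_0}(sX)$, and let $I$ be the set of all $s\in\mathbb R$ for which it is defined. Let $\mathbb V$ be a finite-dimensional smooth real representation of $P$ that is completely reducible (every $P$-invariant subspace has a $P$-invariant complement). For $A\in\mathfrak p$ and $\ell\in\mathbb R$ let $\mathbb V^{[\ell]}(A)$ be the $\ell$-eigenspace of $A$ acting on $\mathbb V$ by the derivative of the representation. The component in $\mathbb V^{[\ell]}(A)$ of a vector that lies in the (automatically direct) sum of the eigenspaces of $A$ is its summand in $\mathbb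 V^{[\ell]}(A)$. **Proposition.** Let $\tau:B\to\mathbb V$ be a smooth function with $\tau(bp)=p^{-1}\tau(b)$ for all $b\in B$, $p\in P$ (equivalently, a smooth section of $B\times_P\mathbb V$) that is invariant under the local flow of $\tilde\eta$, i.e. constant along the integral curves of $\tilde\eta$. Let $X\in T(Z)$ be such that $A=[Z,X]\in\mathfrak g_0$. Then there are vectors $v^{[-k]}\in\mathbb V^{[-k]}(A)$, $k=0,1,2,\dots$, only finitely many of them nonzero, such that for all $s\in I$ the vector $\tau(\tilde\gamma_X(s))$ lies in the sum of the eigenspaces of $A$; for every $k\ge 0$ its component in $\mathbb V^{[-k]}(A)$ is $$(\tau\circ\tilde\gamma_X)^{[-k]}(s)=s^k\,v^{[-k]};$$ and $$(\tau\circ\tilde\gamma_X)(s)=\sum_{k\ge 0}s^k\,v^{[-k]} .$$ -/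

import Mathlib

open scoped Manifold ContDiff

noncomputable section

namespace ParabolicGeometry

/-! ### Parabolic subalgebras, their filtrations and algebraic Weyl structures -/

section Algebra

variable {L : Type*} [LieRing L] [LieAlgebra ℝ L]

/-- The nilradical: the largest ideal that is nilpotent as a Lie algebra.
(Mathlib's `LieAlgebra.maxNilpotentIdeal` is a different object: it asks the whole Lie algebra to
act nilpotently on the ideal.) -/
def lieNilradical (K : Type*) [LieRing K] [LieAlgebra ℝ K] : LieIdeal ℝ K :=
  sSup {N : LieIdeal ℝ K | LieRing.IsNilpotent N}

/-- The nilradical `𝔭₊` of a subalgebra `𝔭`, as a subspace of the ambient Lie algebra. -/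
def positivePart (𝔭 : LieSubalgebra ℝ L) : Submodule ℝ L :=
  (lieNilradical 𝔭).toSubmodule.map 𝔭.toSubmodule.subtype

/-- A subalgebra is parabolic if its orthogonal complement for the Killing form is its
nilradical. -/
def IsParabolic (𝔭 : LieSubalgebra ℝ L) : Prop :=
  (killingForm ℝ L).orthogonal 𝔭.toSubmodule = positivePart 𝔭

/-- The span of all brackets `⁅u, w⁆` with `u ∈ U` and `w ∈ W`. -/
def bracketSpan (U W : Submodule ℝ L) : Submodule ℝ L :=
  Submodule.span ℝ {z | ∃ u ∈ U, ∃ w ∈ W, ⁅u, w⁆ = z}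

/-- The lower central series of `𝔭₊`; the entry with index `i` is `𝔤^{i+1}`. -/
def lowerSeries (𝔭 : LieSubalgebra ℝ L) : ℕ → Submodule ℝ L
  | 0 => positivePart 𝔭
  | i + 1 => bracketSpan (lowerSeries 𝔭 i) (positivePart 𝔭)

/-- The filtration `𝔤^i`, `i ∈ ℤ`: `𝔤^1 = 𝔭₊`, `𝔤^i = [𝔤^{i-1}, 𝔭₊]` for `i ≥ 2`, and
`𝔤^{1-j} = (𝔤^j)^⊥` for `j ≥ 1`. -/
def filtration (𝔭 : LieSubalgebra ℝ L) (i : ℤ) : Submodule ℝ L :=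
  if 1 ≤ i then lowerSeries 𝔭 (i - 1).toNat
  else (killingForm ℝ L).orthogonal (lowerSeries 𝔭 (-i).toNat)

/-- An algebraic Weyl structure: a Lie algebra grading that splits the filtration of `𝔭`. -/
structure WeylStructure (𝔭 : LieSubalgebra ℝ L) where
  /-- The graded pieces `𝔤_i`. -/
  grade : ℤ → Submodule ℝ L
  isInternal : DirectSum.IsInternal grade
  bracket_mem : ∀ (i j : ℤ) (x y : L), x ∈ grade i → y ∈ grade j → ⁅x, y⁆ ∈ grade (i + j)
  filtration_eq : ∀ i : ℤ, filtration 𝔭 i = ⨆ j : ℤ, ⨆ _ : i ≤ j, grade j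

/-- The complement `𝔤₋ = ⨁_{j < 0} 𝔤_j` of `𝔭`. -/
def WeylStructure.negativePart {𝔭 : LieSubalgebra ℝ L} (𝒲 : WeylStructure 𝔭) : Submodule ℝ L :=
  ⨆ j : ℤ, ⨆ _ : j < 0, 𝒲.grade j

/-- The set `T(Z)` of all `X ∈ 𝔤₋` such that, with `A = ⁅Z, X⁆`, one has `⁅A, Z⁆ = 2 Z` and
`⁅A, X⁆ = -2 X`. -/
def counterpart {𝔭 : LieSubalgebra ℝ L} (𝒲 : WeylStructure 𝔭) (Z : L) : Set L :=
  {X | X ∈ 𝒲.negativePart ∧ ⁅⁅Z, X⁆, Z⁆ = (2 : ℝ) • Z ∧ ⁅⁅Z, X⁆, X⁆ = (-2 : ℝ) • X}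

end Algebra

/-! ### Lie groups and subgroups -/

/-- Lets instance search find the Lie bracket on the tangent space at `1` of a smooth real Lie
group. -/
instance leInfty_minSmoothness_three : ENat.LEInfty (minSmoothness ℝ 3) :=
  ⟨by rw [minSmoothness_of_isRCLikeNormedField]; exact ENat.LEInfty.out⟩

section Groups

variable {n : ℕ} {G : Type*} [TopologicalSpace G] [ChartedSpace (EuclideanSpace ℝ (Fin n)) G]
  [Group G]

/-- Linear coordinates on the Lie algebra, used to speak about smoothness of maps into it. -/
def lieCoord : GroupLieAlgebra (𝓡 n) G ≃L[ℝ] EuclideanSpace ℝ (Fin n) where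
  toFun v := v
  invFun v := v
  map_add' _ _ := rfl
  map_smul' _ _ := rfl
  left_inv _ := rfl
  right_inv _ := rfl
  continuous_toFun := continuous_id
  continuous_invFun := continuous_id

/-- The adjoint action: the derivative at `1` of conjugation by `g`. -/
def adjoint (g : G) : GroupLieAlgebra (𝓡 n) G →L[ℝ] GroupLieAlgebra (𝓡 n) G :=
  mfderiv (𝓡 n) (𝓡 n) (fun x : G => g * x * g⁻¹) 1

variable {r : ℕ} (P : Subgroup G) [ChartedSpace (EuclideanSpace ℝ (Fin r)) P]

/-- The given smooth structure on the subgroup `P`, with its subspace topology, makes `P` an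
embedded Lie subgroup of `G`. -/
def IsLieSubgroup : Prop :=
  ContMDiff (𝓡 r) (𝓡 n) ∞ (Subtype.val : P → G) ∧
    ∀ p : P, Function.Injective (mfderiv (𝓡 r) (𝓡 n) (Subtype.val : P → G) p)

/-- The map `Lie(P) → 𝔤` induced by the inclusion `P ⊆ G`. -/
def lieInclusion : GroupLieAlgebra (𝓡 r) P →L[ℝ] GroupLieAlgebra (𝓡 n) G :=
  mfderiv (𝓡 r) (𝓡 n) (Subtype.val : P → G) 1

end Groups

/-! ### Representations -/

section Representations

variable {r : ℕ} {P : Type*} [TopologicalSpace P] [ChartedSpace (EuclideanSpace ℝ (Fin r)) P]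
  [Group P] {V : Type*} [NormedAddCommGroup V] [NormedSpace ℝ V]

/-- Every `P`-invariant subspace of the representation has a `P`-invariant complement. -/
def IsCompletelyReducible (ρ : P →* (V →L[ℝ] V)) : Prop :=
  Representation.IsSemisimpleRepresentation
    ((ContinuousLinearMap.toLinearMapRingHom : (V →L[ℝ] V) →+* (V →ₗ[ℝ] V)).toMonoidHom.comp ρ :
      Representation ℝ P V)

/-- The action of an element of `Lie(P)` on `V`: the derivative at `1` of the representation. -/
def infinitesimalAction (ρ : P →* (V →L[ℝ] V)) (Y : GroupLieAlgebra (𝓡 r) P) :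
    Module.End ℝ V :=
  ((NormedSpace.fromTangentSpace (𝕜 := ℝ) (ρ 1)
    (mfderiv (𝓡 r) 𝓘(ℝ, V →L[ℝ] V) (fun p : P => ρ p) 1 Y) : V →L[ℝ] V) : V →ₗ[ℝ] V)

end Representations

/-- `y` is the component of `x` in the eigenspace `V^{[μ]}` of `T`: `x` is the sum of `y ∈ V^{[μ]}`
and an element of the sum of the other eigenspaces. Such a `y` is unique, because eigenspaces are
independent; see `IsEigenComponent.unique`. -/
def IsEigenComponent {V : Type*} [AddCommGroup V] [Module ℝ V] (T : Module.End ℝ V) (μ : ℝ)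
    (x y : V) : Prop :=
  y ∈ T.eigenspace μ ∧ x - y ∈ ⨆ ν : ℝ, ⨆ _ : ν ≠ μ, T.eigenspace ν

theorem IsEigenComponent.unique {V : Type*} [AddCommGroup V] [Module ℝ V] {T : Module.End ℝ V}
    {μ : ℝ} {x y y' : V} (h : IsEigenComponent T μ x y) (h' : IsEigenComponent T μ x y') :
    y = y' := by
  have h1 : y - y' ∈ T.eigenspace μ := Submodule.sub_mem _ h.1 h'.1
  have h2 : y - y' ∈ ⨆ ν : ℝ, ⨆ _ : ν ≠ μ, T.eigenspace ν := by
    have := Submodule.sub_mem _ h'.2 h.2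
    simpa using this
  exact sub_eq_zero.1 (Submodule.disjoint_def.1 (T.eigenspaces_iSupIndep μ) _ h1 h2)

/-! ### Cartan geometries -/

/-- A smooth Cartan geometry `(π : B → M, ω)` of type `(𝔤, P)`, where `𝔤` is the Lie algebra
of `G`: a smooth principal right `P`-bundle with a Cartan connection. -/
structure CartanGeometry {n r m : ℕ}
    {G : Type*} [TopologicalSpace G] [ChartedSpace (EuclideanSpace ℝ (Fin n)) G] [Group G]
    (P : Subgroup G) [ChartedSpace (EuclideanSpace ℝ (Fin r)) P]
    (B : Type*) [TopologicalSpace B] [ChartedSpace (EuclideanSpace ℝ (Fin n)) B]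
    [IsManifold (𝓡 n) ∞ B]
    (M : Type*) [TopologicalSpace M] [ChartedSpace (EuclideanSpace ℝ (Fin m)) M] where
  /-- The bundle projection `π`. -/
  proj : B → M
  contMDiff_proj : ContMDiff (𝓡 n) (𝓡 m) ∞ proj
  /-- The principal right action `(b, p) ↦ b p`. -/
  act : B → P → B
  act_one : ∀ b, act b 1 = b
  act_mul : ∀ b p q, act b (p * q) = act (act b p) q
  contMDiff_act : ContMDiff ((𝓡 n).prod (𝓡 r)) (𝓡 n) ∞ (fun x : B × P => act x.1 x.2)
  proj_act : ∀ b p, proj (act b p) = proj b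
  /-- Smooth `P`-equivariant local trivializations. -/
  exists_trivialization : ∀ x : M, ∃ e : Bundle.Trivialization P proj, x ∈ e.baseSet ∧
    ContMDiffOn (𝓡 n) ((𝓡 m).prod (𝓡 r)) ∞ e e.source ∧
    ContMDiffOn ((𝓡 m).prod (𝓡 r)) (𝓡 n) ∞ e.toOpenPartialHomeomorph.symm e.target ∧
    ∀ b ∈ e.source, ∀ p : P, (e (act b p)).2 = (e b).2 * p
  /-- The Cartan connection `ω`, an isomorphism `T_b B → 𝔤` at every point `b`. -/
  conn : ∀ b : B, TangentSpace (𝓡 n) b ≃L[ℝ] GroupLieAlgebra (𝓡 n) G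
  contMDiff_conn : ContMDiff (𝓡 n).tangent 𝓘(ℝ, EuclideanSpace ℝ (Fin n)) ∞
    (fun v : TangentBundle (𝓡 n) B => lieCoord (conn v.1 v.2))
  /-- Equivariance: `R_p^* ω = Ad(p⁻¹) ω`. -/
  conn_act : ∀ (b : B) (p : P) (v : TangentSpace (𝓡 n) b),
    conn (act b p) (mfderiv (𝓡 n) (𝓡 n) (fun b' => act b' p) b v) = adjoint ((p : G)⁻¹) (conn b v)
  /-- `ω` reproduces the generators of fundamental vector fields. -/
  conn_fundamental : ∀ (b : B) (Y : GroupLieAlgebra (𝓡 r) P),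
    conn (act b 1) (mfderiv (𝓡 r) (𝓡 n) (act b) 1 Y) = lieInclusion P Y

namespace CartanGeometry

variable {n r m : ℕ}
  {G : Type*} [TopologicalSpace G] [ChartedSpace (EuclideanSpace ℝ (Fin n)) G] [Group G]
  {P : Subgroup G} [ChartedSpace (EuclideanSpace ℝ (Fin r)) P]
  {B : Type*} [TopologicalSpace B] [ChartedSpace (EuclideanSpace ℝ (Fin n)) B]
  [IsManifold (𝓡 n) ∞ B]
  {M : Type*} [TopologicalSpace M] [ChartedSpace (EuclideanSpace ℝ (Fin m)) M]
  (𝒢 : CartanGeometry (n := n) (r := r) (m := m) P B M)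

/-- The `ω`-constant vector field `X̃`, with `ω(X̃) = X`. -/
def constField (X : GroupLieAlgebra (𝓡 n) G) (b : B) : TangentSpace (𝓡 n) b :=
  (𝒢.conn b).symm X

/-- The Lie derivative of `ω`: `(L_η ω)(W) = η · ω(W) - ω([η, W])`. -/
def lieDerivConnection (η W : ∀ b : B, TangentSpace (𝓡 n) b) (b : B) :
    EuclideanSpace ℝ (Fin n) :=
  NormedSpace.fromTangentSpace (𝕜 := ℝ) (lieCoord (𝒢.conn b (W b)))
      (mfderiv (𝓡 n) 𝓘(ℝ, EuclideanSpace ℝ (Fin n))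
        (fun b' => lieCoord (𝒢.conn b' (W b'))) b (η b))
    - lieCoord (𝒢.conn b (VectorField.mlieBracket (𝓡 n) η W b))

/-- Infinitesimal automorphisms of `(B, ω)`: smooth `P`-invariant vector fields `η` on `B`
with `L_η ω = 0`. -/
def IsInfinitesimalAutomorphism (η : ∀ b : B, TangentSpace (𝓡 n) b) : Prop :=
  ContMDiff (𝓡 n) (𝓡 n).tangent ∞ (fun b => (⟨b, η b⟩ : TangentBundle (𝓡 n) B)) ∧
  (∀ (b : B) (p : P),
    mfderiv (𝓡 n) (𝓡 n) (fun b' => 𝒢.act b' p) b (η b) = η (𝒢.act b p)) ∧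
  ∀ W : (∀ b : B, TangentSpace (𝓡 n) b),
    ContMDiff (𝓡 n) (𝓡 n).tangent ∞ (fun b => (⟨b, W b⟩ : TangentBundle (𝓡 n) B)) →
    ∀ b : B, 𝒢.lieDerivConnection η W b = 0

/-- `c` is an integral curve of `X̃` with `c 0 = b`, defined on an open interval that
contains `[0, 1]`. -/
def IsUnitFlowLine (b : B) (X : GroupLieAlgebra (𝓡 n) G) (c : ℝ → B) : Prop :=
  c 0 = b ∧ ∃ t₀ t₁ : ℝ, t₀ < 0 ∧ 1 < t₁ ∧
    IsMIntegralCurveOn c (𝒢.constField X) (Set.Ioo t₀ t₁)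

/-- The domain of `exp_b`: all `X` for which the flow of `X̃` starting at `b` exists up to
time `1`. -/
def expDomain (b : B) : Set (GroupLieAlgebra (𝓡 n) G) :=
  {X | ∃ c : ℝ → B, 𝒢.IsUnitFlowLine b X c}

open Classical in
/-- The exponential map `exp_b(X)`, the time-one flow of `X̃` starting at `b`
(with the value `b` outside its domain). -/
def exp (b : B) (X : GroupLieAlgebra (𝓡 n) G) : B :=
  if h : ∃ c : ℝ → B, 𝒢.IsUnitFlowLine b X c then h.choose 1 else b

/-- The exponential curve `γ̃_X(s) = exp_b(s X)`. -/
def expCurve (b : B) (X : GroupLieAlgebra (𝓡 n) G) (s : ℝ) : B :=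
  𝒢.exp b (s • X)

/-- The domain `I` of the exponential curve `γ̃_X`. -/
def expCurveDomain (b : B) (X : GroupLieAlgebra (𝓡 n) G) : Set ℝ :=
  {s | s • X ∈ 𝒢.expDomain b}

end CartanGeometry

/-- The function `τ` is invariant under the local flow of the vector field `η`: it is constant
along every integral curve of `η`. -/
def IsFlowInvariant {n : ℕ} {B : Type*} [TopologicalSpace B]
    [ChartedSpace (EuclideanSpace ℝ (Fin n)) B] {V : Type*}
    (η : ∀ b : B, TangentSpace (𝓡 n) b) (τ : B → V) : Prop :=
  ∀ (c : ℝ → B) (t₀ t₁ : ℝ), IsMIntegralCurveOn c η (Set.Ioo t₀ t₁) →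
    ∀ s ∈ Set.Ioo t₀ t₁, ∀ t ∈ Set.Ioo t₀ t₁, τ (c s) = τ (c t)

end ParabolicGeometry

end

/-! Let `c` be an integral curve of X̃ with c(0) = b₀. Because L_η ω = 0 and ω(X̃) is constant, η
commutes with X̃, so u ↦ ω(η)(c(u)) solves the linear equation y' = -ω([X̃, ỹ]). The curve Z + uA -
u²X solves it as well: Z and A lie in 𝔭, so the brackets of Z̃ and Ã with X̃ are the algebraic ones,
without curvature, and [X̃, X̃] = 0. Uniqueness gives ω(η) = Z + uA - u²X along `c`
(`IsInfinitesimalAutomorphism.eqOn_constField`).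

Now differentiate τ along η. Invariance makes the result zero, and equivariance turns derivatives
along Z̃ and Ã into minus the infinitesimal action, so 0 = -Zτ - uAτ - u²τ' along `c`. In a
completely reducible representation 𝔭₊ acts by zero
(`infinitesimalAction_eq_zero_of_mem_positivePart`): the grading element shows that 𝔭₊ acts by a
nilpotent space N of operators, and N kills every invariant complement of NV, so NV = N²V = ... = 0.
What remains is the Euler equation u g' = -A g for g = τ ∘ c.

This equation is singular at 0, but g is smooth there. The k-th derivative of g solves the same
equation with A + k in place of A, and for k > ‖A‖ that equation has only the zero solution. Hence g
is a polynomial, and integrating back shows that its k-th coefficient is an eigenvector of A for -k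
(`eulerEquation_exists_polynomial`).

All the bracket identities come from one computation, `mlieBracket_eq_neg_of_mfderiv_act`, applied
to G acting on itself by right translations, which gives the derivative of Ad, and to P acting on B,
which gives [Ỹ, X̃] for Y in 𝔭. Finally, each value exp(sX) comes with its own integral curve; local
uniqueness near 0 shows that all these curves yield the same coefficients. -/

/-! ### Regular singular linear differential equations -/

section EulerEquation

open Set

variable {V : Type*} [NormedAddCommGroup V] [NormedSpace ℝ V]

/-- A differentiable solution of `u h' = -(A + n) h` with `‖A‖ < n` on an interval
around `0` vanishes. -/
theorem eulerEquation_eq_zero_of_norm_lt {A : V →L[ℝ] V} {n : ℕ} (hn : ‖A‖ < n)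
    {J : Set ℝ} (hJ : J.OrdConnected) (h0 : (0 : ℝ) ∈ J) {h h' : ℝ → V}
    (hd : ∀ u ∈ J, HasDerivAt h (h' u) u)
    (he : ∀ u ∈ J, u • h' u = -(A (h u) + (n : ℝ) • h u)) :
    ∀ u ∈ J, h u = 0 := by
  have hn0 : (0 : ℝ) < n := (norm_nonneg A).trans_lt hn
  have hn1 : n ≠ 0 := by rintro rfl; simp at hn0
  intro u hu
  have hsub : uIcc 0 u ⊆ J := hJ.uIcc_subset h0 hu
  have hcont : ContinuousOn (fun t => ‖h t‖) (uIcc 0 u) := fun t ht =>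
    ((hd t (hsub ht)).continuousAt.norm).continuousWithinAt
  -- The largest value C of ‖h‖ between 0 and u will be shown to satisfy C ≤ (‖A‖ / n) C, which
  -- forces C = 0.
  obtain ⟨w, hw, hmax⟩ := isCompact_uIcc.exists_isMaxOn ⟨0, left_mem_uIcc⟩ hcont
  set C := ‖h w‖ with hC
  have hmul : ∀ t ∈ Icc (0 : ℝ) 1, t * w ∈ uIcc 0 u := by
    intro t ht
    have h1 : t * w ∈ uIcc 0 w := by
      rcases le_total 0 w with h | h
      · rw [uIcc_of_le h]
        exact ⟨mul_nonneg ht.1 h, mul_le_of_le_one_left h ht.2⟩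
      · rw [uIcc_of_ge h]
        exact ⟨by nlinarith [ht.2], mul_nonpos_of_nonneg_of_nonpos ht.1 h⟩
    exact uIcc_subset_uIcc left_mem_uIcc hw h1
  -- The integrating factor tⁿ absorbs the term n • h of the equation and leaves only the one with
  -- A.
  have hder : ∀ t ∈ Icc (0 : ℝ) 1,
      HasDerivAt (fun t : ℝ => t ^ n • h (t * w)) (-(t ^ (n - 1) • A (h (t * w)))) t := by
    intro t ht
    have h1 : HasDerivAt (fun t : ℝ => h (t * w)) (w • h' (t * w)) t := by
      have := (hd (t * w) (hsub (hmul t ht))).scomp t ((hasDerivAt_id t).mul_const w)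
      simpa [Function.comp_def] using this
    have h2 := (hasDerivAt_pow n t).smul h1
    convert! h2 using 1
    have h3 := he (t * w) (hsub (hmul t ht))
    obtain ⟨k, rfl⟩ := Nat.exists_eq_succ_of_ne_zero hn1
    have h4 : t ^ (k + 1) • w • h' (t * w) = t ^ k • ((t * w) • h' (t * w)) := by
      simp only [smul_smul]; ring_nf
    simp only [Nat.succ_eq_add_one, Nat.add_sub_cancel] at *
    rw [h4, h3]
    simp only [smul_neg, smul_add, smul_smul]
    rw [mul_comm ((k + 1 : ℕ) : ℝ)]
    abel
  -- The derivative is at most ‖A‖ C tⁿ⁻¹ in norm, and integrating this from 0 to 1 produces the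
  -- factor 1 / n.
  have hbound : ‖(1 : ℝ) ^ n • h (1 * w)‖ ≤ ‖A‖ * C / n * (1 : ℝ) ^ n := by
    refine image_norm_le_of_norm_deriv_right_le_deriv_boundary' (a := 0) (b := 1)
      (f := fun t : ℝ => t ^ n • h (t * w)) (f' := fun t => -(t ^ (n - 1) • A (h (t * w))))
      (B := fun t => ‖A‖ * C / n * t ^ n) (B' := fun t => ‖A‖ * C * t ^ (n - 1))
      (fun t ht => (hder t ht).continuousAt.continuousWithinAt)
      (fun t ht => (hder t ⟨ht.1, ht.2.le⟩).hasDerivWithinAt) ?_ ?_ ?_ ?_ ⟨zero_le_one, le_rfl⟩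
    · simp [hn1]
    · exact (by fun_prop : Continuous fun t : ℝ => ‖A‖ * C / n * t ^ n).continuousOn
    · intro t _
      have := ((hasDerivAt_pow n t).const_mul (‖A‖ * C / n)).hasDerivWithinAt (s := Ici t)
      rwa [← mul_assoc, div_mul_cancel₀ _ hn0.ne'] at this
    · intro t ht
      rw [norm_neg, norm_smul, norm_pow, Real.norm_of_nonneg ht.1, mul_comm]
      refine mul_le_mul_of_nonneg_right ?_ (pow_nonneg ht.1 _)
      exact (A.le_opNorm _).trans (mul_le_mul_of_nonneg_left
        (hmax (hmul t ⟨ht.1, ht.2.le⟩)) (norm_nonneg _))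
  simp only [one_pow, one_smul, one_mul, mul_one] at hbound
  have hC0 : C = 0 := by
    by_contra hne
    have hpos : 0 < C := lt_of_le_of_ne (norm_nonneg _) (Ne.symm hne)
    have h5 : C ≤ ‖A‖ * C / n := hbound
    rw [le_div_iff₀ hn0] at h5
    nlinarith
  have h6 : ‖h u‖ ≤ C := hmax right_mem_uIcc
  exact norm_le_zero_iff.1 (h6.trans hC0.le)

/-- Smooth solutions of `u g' = -A g` around `0` are polynomial, provided that those of
`u g' = -(A + n) g` vanish. -/
theorem eulerEquation_exists_sum {J : Set ℝ} (hJo : IsOpen J) (hJ : J.OrdConnected)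
    (h0 : (0 : ℝ) ∈ J) (n : ℕ) : ∀ (A : V →L[ℝ] V)
    (_ : ∀ h : ℝ → V, ContDiffOn ℝ ∞ h J →
      (∀ u ∈ J, u • deriv h u = -(A (h u) + (n : ℝ) • h u)) → ∀ u ∈ J, h u = 0)
    (g : ℝ → V) (_ : ContDiffOn ℝ ∞ g J) (_ : ∀ u ∈ J, u • deriv g u = -A (g u)),
    ∃ v : ℕ → V, (∀ k, A (v k) = -(k : ℝ) • v k) ∧ (∀ k, n ≤ k → v k = 0) ∧
      ∀ u ∈ J, g u = ∑ k ∈ Finset.range n, u ^ k • v k := by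
  induction n with
  | zero =>
    intro A hA g hg he
    exact ⟨0, by simp, by simp, fun u hu => by simpa using hA g hg (by simpa using he) u hu⟩
  | succ n ih =>
    intro A hA g hg he
    have hdiff : ∀ u ∈ J, DifferentiableAt ℝ g u := fun u hu =>
      (hg.contDiffAt (hJo.mem_nhds hu)).differentiableAt (by simp)
    have hg' : ContDiffOn ℝ ∞ (deriv g) J := hg.deriv_of_isOpen hJo (by simp)
    have hdiff' : ∀ u ∈ J, DifferentiableAt ℝ (deriv g) u := fun u hu =>
      (hg'.contDiffAt (hJo.mem_nhds hu)).differentiableAt (by simp)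
    -- Differentiating u g' = -A g replaces A by A + 1, so the vanishing hypothesis for A + (n + 1)
    -- is the one for (A + 1) + n that the induction needs.
    have he' : ∀ u ∈ J, u • deriv (deriv g) u
        = -(A + ContinuousLinearMap.id ℝ V) (deriv g u) := by
      intro u hu
      have h1 : HasDerivAt (fun t => t • deriv g t) (u • deriv (deriv g) u + (1 : ℝ) • deriv g u) u :=
        (hasDerivAt_id u).smul (hdiff' u hu).hasDerivAt
      have h2 : HasDerivAt (fun t => -A (g t)) (-A (deriv g u)) u :=
        (A.hasFDerivAt.comp_hasDerivAt u (hdiff u hu).hasDerivAt).neg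
      have h3 : (fun t => t • deriv g t) =ᶠ[nhds u] fun t => -A (g t) :=
        Filter.eventually_of_mem (hJo.mem_nhds hu) he
      have h4 := h1.unique (h2.congr_of_eventuallyEq h3)
      rw [one_smul] at h4
      simp only [_root_.add_apply, ContinuousLinearMap.id_apply, neg_add]
      rw [← h4]; abel
    obtain ⟨w, hw1, hw2, hw3⟩ := ih (A + ContinuousLinearMap.id ℝ V) (by
      intro h hh hhe
      refine hA h hh fun u hu => ?_
      rw [hhe u hu]
      simp only [_root_.add_apply, ContinuousLinearMap.id_apply, Nat.cast_succ,
        add_smul, one_smul]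
      abel_nf) (deriv g) hg' he'
    have hAg0 : A (g 0) = 0 := by
      have := he 0 h0
      rw [zero_smul] at this
      exact neg_eq_zero.1 this.symm
    -- Termwise antiderivative of the polynomial for g'. An eigenvector of A + 1 for -k is one of A
    -- for -(k + 1), and g(0) is killed by A because the equation at u = 0 says so.
    refine ⟨fun k => if k = 0 then g 0 else (k : ℝ)⁻¹ • w (k - 1), ?_, ?_, ?_⟩
    · rintro (_ | k)
      · simp [hAg0]
      · have h1 := hw1 k
        simp only [_root_.add_apply, ContinuousLinearMap.id_apply] at h1
        have h2 : A (w k) = -((k + 1 : ℕ) : ℝ) • w k := by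
          rw [eq_sub_of_add_eq h1]; push_cast; module
        simp only [Nat.succ_ne_zero, if_false, Nat.add_sub_cancel, map_smul, h2]
        rw [smul_comm]
    · rintro (_ | k) hk
      · omega
      · simp [hw2 k (by omega)]
    · have hconst : ∀ u ∈ J, g u - ∑ k ∈ Finset.range n, u ^ (k + 1) • ((k + 1 : ℕ) : ℝ)⁻¹ • w k
          = g 0 := by
        intro u hu
        have hd : ∀ t ∈ J, HasDerivAt
            (fun t => g t - ∑ k ∈ Finset.range n, t ^ (k + 1) • ((k + 1 : ℕ) : ℝ)⁻¹ • w k) 0 t := by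
          intro t ht
          have h1 : HasDerivAt
              (fun t : ℝ => ∑ k ∈ Finset.range n, t ^ (k + 1) • ((k + 1 : ℕ) : ℝ)⁻¹ • w k)
              (∑ k ∈ Finset.range n, t ^ k • w k) t := by
            refine HasDerivAt.fun_sum fun k _ => ?_
            have h2 := (hasDerivAt_pow (k + 1) t).smul_const (((k + 1 : ℕ) : ℝ)⁻¹ • w k)
            convert! h2 using 1
            rw [smul_smul, Nat.add_sub_cancel]
            congr 1
            have : ((k + 1 : ℕ) : ℝ) ≠ 0 := by positivity
            field_simp
          have h3 := (hdiff t ht).hasDerivAt.sub h1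
          rwa [hw3 t ht, sub_self] at h3
        have hconv : Convex ℝ J := hJ.convex
        have h4 := hconv.is_const_of_fderivWithin_eq_zero (𝕜 := ℝ)
          (f := fun t => g t - ∑ k ∈ Finset.range n, t ^ (k + 1) • ((k + 1 : ℕ) : ℝ)⁻¹ • w k)
          (fun t ht => (hd t ht).differentiableAt.differentiableWithinAt)
          (fun t ht => by
            rw [fderivWithin_of_isOpen hJo ht]
            rw [(hd t ht).hasFDerivAt.fderiv]
            ext; simp) hu h0
        simpa using h4
      intro u hu
      rw [Finset.sum_range_succ']
      simp only [Nat.succ_ne_zero, if_false, Nat.add_sub_cancel, pow_zero, one_smul, if_true]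
      rw [← hconst u hu]; abel

/-- Smooth solutions of `u g' = -A g` on an interval around `0` are polynomials whose coefficients
are eigenvectors of `A`. -/
theorem eulerEquation_exists_polynomial {A : V →L[ℝ] V} {n : ℕ} (hn : ‖A‖ < n)
    {J : Set ℝ} (hJo : IsOpen J) (hJ : J.OrdConnected) (h0 : (0 : ℝ) ∈ J) {g : ℝ → V}
    (hg : ContDiffOn ℝ ∞ g J) (he : ∀ u ∈ J, u • deriv g u = -A (g u)) :
    ∃ v : ℕ → V, (∀ k, A (v k) = -(k : ℝ) • v k) ∧ (∀ k, n ≤ k → v k = 0) ∧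
      ∀ u ∈ J, g u = ∑ k ∈ Finset.range n, u ^ k • v k :=
  -- After n > ‖A‖ differentiations the norm estimate applies.
  eulerEquation_exists_sum hJo hJ h0 n A (fun _ hh hhe =>
    eulerEquation_eq_zero_of_norm_lt hn hJ h0 (fun u hu =>
      ((hh.contDiffAt (hJo.mem_nhds hu)).differentiableAt (by simp)).hasDerivAt) hhe) g hg he

end EulerEquation

noncomputable section

/-! ### Nilpotent spaces of operators -/

section NilpotentOperators

variable {V : Type*} [AddCommGroup V] [Module ℝ V]

/-- If a nilpotent space `N` of operators preserves a complement of the span `N V` of its images,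
then it acts by zero. -/
theorem apply_eq_zero_of_pow_eq_bot_of_isCompl {N : Submodule ℝ (Module.End ℝ V)} {k : ℕ}
    (hk : N ^ k = ⊥) {W : Submodule ℝ V}
    (hW : IsCompl (Submodule.span ℝ {x | ∃ z ∈ N, ∃ v, z v = x}) W)
    (hNW : ∀ z ∈ N, ∀ w ∈ W, z w ∈ W) {z : Module.End ℝ V} (hz : z ∈ N) (v : V) : z v = 0 := by
  set U := Submodule.span ℝ {x | ∃ z ∈ N, ∃ v, z v = x} with hU
  have hU_mem : ∀ z ∈ N, ∀ v, z v ∈ U := fun z hz v => Submodule.subset_span ⟨z, hz, v, rfl⟩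
  -- NV ⊆ N^{j+1}V for every j: write v = u + w along the decomposition. Then z w lies in NV ∩ W =
  -- 0, while u is already in N^{j+1}V, so z v = z u lies one power further.
  have key : ∀ j : ℕ, ∀ z ∈ N, ∀ v,
      z v ∈ Submodule.span ℝ {x | ∃ y ∈ N ^ (j + 1), ∃ v, y v = x} := by
    intro j
    induction j with
    | zero => exact fun z hz v => Submodule.subset_span ⟨z, by simpa using hz, v, rfl⟩
    | succ j ih =>
      intro z hz v
      have hv : v ∈ U ⊔ W := by rw [hW.sup_eq_top]; trivial
      obtain ⟨u, hu, w, hw, rfl⟩ := Submodule.mem_sup.1 hv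
      have hzw : z w = 0 := Submodule.disjoint_def.1 hW.disjoint _ (hU_mem z hz w) (hNW z hz w hw)
      rw [map_add, hzw, add_zero]
      have hle : U ≤ (Submodule.span ℝ {x | ∃ y ∈ N ^ (j + 1 + 1), ∃ v, y v = x}).comap z := by
        refine (Submodule.span_le.2 ?_ :
          U ≤ Submodule.span ℝ {x | ∃ y ∈ N ^ (j + 1), ∃ v, y v = x}).trans (Submodule.span_le.2 ?_)
        · rintro _ ⟨y, hy, v, rfl⟩
          exact ih y hy v
        · rintro _ ⟨y, hy, v, rfl⟩
          refine Submodule.subset_span ⟨z * y, ?_, v, rfl⟩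
          rw [Submodule.pow_succ' N (by omega)]
          exact Submodule.mul_mem_mul hz hy
      exact hle hu
  have hbot : N ^ (k + 1) = ⊥ := by rw [Submodule.pow_succ, hk, Submodule.bot_mul]
  have := key k z hz v
  rw [hbot] at this
  have hle : Submodule.span ℝ {x | ∃ y ∈ (⊥ : Submodule ℝ (Module.End ℝ V)), ∃ v, y v = x} ≤ ⊥ := by
    rw [Submodule.span_le]
    rintro _ ⟨y, hy, v, rfl⟩
    rw [(Submodule.mem_bot ℝ).1 hy]
    exact Submodule.zero_mem _
  exact (Submodule.mem_bot ℝ).1 (hle this)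

open scoped Pointwise in
/-- A space of operators spanned by operators of positive degree, with respect to the grading of
`End V` by the eigenvalues of `ad e`, is nilpotent. -/
theorem exists_pow_eq_bot_of_le_span_degree_pos [FiniteDimensional ℝ V] (e : Module.End ℝ V)
    {N : Submodule ℝ (Module.End ℝ V)}
    (hN : N ≤ Submodule.span ℝ {z | ∃ i : ℕ, 1 ≤ i ∧ e * z - z * e = (i : ℝ) • z}) :
    ∃ k : ℕ, N ^ k = ⊥ := by
  set S : Set (Module.End ℝ V) := {z | ∃ i : ℕ, 1 ≤ i ∧ e * z - z * e = (i : ℝ) • z} with hS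
  -- Commutation with e is a derivation, so degrees add and a product of k factors has degree at
  -- least k.
  have hpow : ∀ k : ℕ, ∀ x ∈ S ^ k, ∃ i : ℕ, k ≤ i ∧ e * x - x * e = (i : ℝ) • x := by
    intro k
    induction k with
    | zero => 
      intro x hx
      rw [pow_zero, Set.mem_one] at hx
      exact ⟨0, le_rfl, by rw [hx]; simp⟩
    | succ k ih =>
      intro x hx
      rw [pow_succ] at hx
      obtain ⟨y, hy, z, ⟨j, hj, hz⟩, rfl⟩ := Set.mem_mul.1 hx
      obtain ⟨i, hi, hy⟩ := ih y hy
      refine ⟨i + j, by omega, ?_⟩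
      have : e * (y * z) - y * z * e = (e * y - y * e) * z + y * (e * z - z * e) := by
        noncomm_ring
      rw [this, hy, hz]
      simp [add_smul]
  set D : Module.End ℝ (Module.End ℝ V) := LinearMap.mulLeft ℝ e - LinearMap.mulRight ℝ e with hD
  -- Commutation with e has finitely many eigenvalues on the finite-dimensional space End V, so
  -- nonzero operators of large degree do not exist.
  obtain ⟨k, hk⟩ : ∃ k : ℕ, ∀ i : ℕ, k ≤ i → ¬ D.HasEigenvalue (i : ℝ) := by
    have hfin : {i : ℕ | D.HasEigenvalue (i : ℝ)}.Finite :=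
      (Module.End.finite_hasEigenvalue D).preimage Nat.cast_injective.injOn
    obtain ⟨k, hk⟩ := hfin.bddAbove
    exact ⟨k + 1, fun i hi h => by have := hk h; omega⟩
  refine ⟨k, ?_⟩
  rw [eq_bot_iff]
  refine (pow_le_pow_left' hN k).trans ?_
  rw [Submodule.span_pow, Submodule.span_le]
  intro x hx
  obtain ⟨i, hi, hx⟩ := hpow k x hx
  by_contra hne
  exact hk i hi (Module.End.hasEigenvalue_of_hasEigenvector
    ⟨Module.End.mem_eigenspace_iff.2 hx, by simpa using hne⟩)

end NilpotentOperators

namespace ParabolicGeometry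

/-! ### The grading element and the nilradical -/

section GradingElement

variable {L : Type*} [LieRing L] [LieAlgebra ℝ L] {𝔭 : LieSubalgebra ℝ L}

theorem WeylStructure.positivePart_eq (𝒲 : WeylStructure 𝔭) :
    positivePart 𝔭 = ⨆ j : ℤ, ⨆ _ : 1 ≤ j, 𝒲.grade j := by
  rw [← 𝒲.filtration_eq 1]
  simp [filtration, lowerSeries]

theorem IsParabolic.toSubmodule_eq [FiniteDimensional ℝ L] [LieAlgebra.IsKilling ℝ L]
    (h𝔭 : IsParabolic 𝔭) :
    (killingForm ℝ L).orthogonal (positivePart 𝔭) = 𝔭.toSubmodule := by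
  rw [← h𝔭]
  exact LinearMap.BilinForm.orthogonal_orthogonal
    (LieAlgebra.IsKilling.killingForm_nondegenerate ℝ L)
    (LieModule.traceForm_isSymm ℝ L L).isRefl _

/-- The grading derivation, multiplication by `i` on `𝔤_i`. -/
theorem WeylStructure.exists_linearMap (𝒲 : WeylStructure 𝔭) :
    ∃ D : L →ₗ[ℝ] L, ∀ i : ℤ, ∀ x ∈ 𝒲.grade i, D x = (i : ℝ) • x := by
  classical
  let f := LinearEquiv.ofBijective (DirectSum.coeLinearMap 𝒲.grade) 𝒲.isInternal
  let g : DirectSum ℤ (fun i => 𝒲.grade i) →ₗ[ℝ] L :=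
    DirectSum.toModule ℝ ℤ L fun i => (i : ℝ) • (𝒲.grade i).subtype
  refine ⟨g ∘ₗ f.symm.toLinearMap, fun i x hx => ?_⟩
  have h1 : f (DirectSum.lof ℝ ℤ (fun i => 𝒲.grade i) i ⟨x, hx⟩) = x := by
    exact DirectSum.coeLinearMap_lof 𝒲.grade i ⟨x, hx⟩
  have h2 : f.symm x = DirectSum.lof ℝ ℤ (fun i => 𝒲.grade i) i ⟨x, hx⟩ := by
    rw [LinearEquiv.symm_apply_eq, h1]
  simp [h2, g]

theorem WeylStructure.iSup_grade (𝒲 : WeylStructure 𝔭) : ⨆ i, 𝒲.grade i = ⊤ :=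
  𝒲.isInternal.submodule_iSup_eq_top

/-- The grading element of an algebraic Weyl structure. -/
theorem WeylStructure.exists_gradingElement [FiniteDimensional ℝ L] [LieAlgebra.IsKilling ℝ L]
    (h𝔭 : IsParabolic 𝔭) (𝒲 : WeylStructure 𝔭) :
    ∃ E ∈ 𝔭, ∀ i : ℤ, ∀ x ∈ 𝒲.grade i, ⁅E, x⁆ = (i : ℝ) • x := by
  obtain ⟨D, hD⟩ := 𝒲.exists_linearMap
  have hleib : ∀ x y, D ⁅x, y⁆ = ⁅x, D y⁆ - ⁅y, D x⁆ := by
    intro x y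
    have hx : x ∈ ⨆ i, 𝒲.grade i := by rw [𝒲.iSup_grade]; trivial
    have hy : y ∈ ⨆ i, 𝒲.grade i := by rw [𝒲.iSup_grade]; trivial
    induction hx using Submodule.iSup_induction' with
    | mem i x hx =>
      induction hy using Submodule.iSup_induction' with
      | mem j y hy =>
        rw [hD _ _ (𝒲.bracket_mem i j x y hx hy), hD _ _ hx, hD _ _ hy, lie_smul, lie_smul,
          ← lie_skew x y]
        push_cast
        module
      | zero => simp
      | add y z _ _ h1 h2 => simp only [lie_add, map_add, h1, h2, add_lie]; abel
    | zero => simp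
    | add y z _ _ h1 h2 => simp only [lie_add, map_add, h1, h2, add_lie]; abel
  -- The grading derivation is inner, as are all derivations when the Killing form is nondegenerate.
  obtain ⟨E, hE⟩ := LieDerivation.IsKilling.exists_eq_ad (R := ℝ) (⟨D, hleib⟩ : LieDerivation ℝ L L)
  have hED : ∀ x, ⁅E, x⁆ = D x := fun x => by
    have := congrArg (fun F : LieDerivation ℝ L L => F x) hE
    simpa using this
  refine ⟨E, ?_, fun i x hx => by rw [hED, hD i x hx]⟩
  -- For y in 𝔤_j with j ≥ 1, invariance of the Killing form κ gives j κ(E, y) = κ(E, [E, y]) =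
  -- κ([E, E], y) = 0. So E is orthogonal to 𝔭₊ and therefore lies in 𝔭.
  have hle : positivePart 𝔭 ≤ LinearMap.ker (killingForm ℝ L E) := by
    rw [𝒲.positivePart_eq]
    refine iSup₂_le fun j hj y hy => ?_
    have h1 : killingForm ℝ L E ⁅E, y⁆ = 0 := by
      rw [← LieModule.traceForm_apply_lie_apply]
      simp
    rw [hED, hD j y hy, map_smul, smul_eq_mul] at h1
    exact (mul_eq_zero.1 h1).resolve_left (by norm_cast; omega)
  have hE' : E ∈ 𝔭.toSubmodule := by
    rw [← h𝔭.toSubmodule_eq]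
    intro y hy
    have h2 := hle hy
    rw [LinearMap.mem_ker, LieModule.traceForm_comm] at h2
    exact h2
  exact hE'

end GradingElement

/-- Lie algebra automorphisms that preserve a parabolic subalgebra preserve its nilradical. -/
theorem IsParabolic.map_positivePart_le {L : Type*} [LieRing L] [LieAlgebra ℝ L]
    {𝔭 : LieSubalgebra ℝ L} (h𝔭 : IsParabolic 𝔭) (f : L ≃ₗ⁅ℝ⁆ L) (hf : ∀ x ∈ 𝔭, f.symm x ∈ 𝔭)
    {x : L} (hx : x ∈ positivePart 𝔭) : f x ∈ positivePart 𝔭 := by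
  -- As the orthogonal complement of 𝔭, the nilradical is determined by 𝔭 and the Killing form,
  -- which automorphisms preserve.
  rw [← h𝔭] at hx ⊢
  rw [LinearMap.BilinForm.mem_orthogonal_iff] at hx ⊢
  intro y hy
  have := hx (f.symm y) (hf y hy)
  rw [← this, ← LieAlgebra.killingForm_of_equiv_apply f (f.symm y) x, f.apply_symm_apply]

/-- In a finite-dimensional representation of a parabolic subalgebra (given on a vector space `Q`
identified with `𝔭` by `ι`), the nilradical acts by a nilpotent space of operators. -/
theorem WeylStructure.exists_pow_map_positivePart_eq_bot {L : Type*} [LieRing L] [LieAlgebra ℝ L]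
    [FiniteDimensional ℝ L] [LieAlgebra.IsKilling ℝ L]
    {𝔭 : LieSubalgebra ℝ L} (h𝔭 : IsParabolic 𝔭) (𝒲 : WeylStructure 𝔭)
    {Q : Type*} [AddCommGroup Q] [Module ℝ Q] (ι : Q →ₗ[ℝ] L) (hinj : Function.Injective ι)
    (hι : ∀ x, x ∈ 𝔭 ↔ ∃ q, ι q = x) {V : Type*} [AddCommGroup V] [Module ℝ V]
    [FiniteDimensional ℝ V] (σ : Q →ₗ[ℝ] Module.End ℝ V)
    (hσ : ∀ x y z, ι z = ⁅ι x, ι y⁆ → σ x * σ y - σ y * σ x = σ z) :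
    ∃ k : ℕ, (((positivePart 𝔭).comap ι).map σ) ^ k = ⊥ := by
  obtain ⟨E, hE, hEi⟩ := 𝒲.exists_gradingElement h𝔭
  obtain ⟨e, rfl⟩ := (hι E).1 hE
  -- Degrees are measured by commutation with the image of the grading element; 𝔤_j acts by
  -- operators of degree j, and only j ≥ 1 occurs in 𝔭₊.
  refine exists_pow_eq_bot_of_le_span_degree_pos (σ e) ?_
  rw [Submodule.map_le_iff_le_comap]
  intro q hq
  have hle : positivePart 𝔭 ≤ ((Submodule.span ℝ {z | ∃ i : ℕ, 1 ≤ i ∧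
      σ e * z - z * σ e = (i : ℝ) • z}).comap σ).map ι := by
    rw [𝒲.positivePart_eq]
    refine iSup₂_le fun j hj x hx => ?_
    have hxp : x ∈ positivePart 𝔭 := by
      rw [𝒲.positivePart_eq]
      exact Submodule.mem_iSup_of_mem j (Submodule.mem_iSup_of_mem hj hx)
    obtain ⟨y, -, hy⟩ := hxp
    obtain ⟨q, rfl⟩ := (hι x).1 (hy ▸ y.2)
    refine ⟨q, Submodule.subset_span ⟨j.toNat, by omega, ?_⟩, rfl⟩
    have hjj : ((j.toNat : ℕ) : ℝ) = (j : ℝ) := by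
      rw [← Int.cast_natCast, Int.toNat_of_nonneg (by omega)]
    rw [hσ e q ((j : ℝ) • q) (by rw [map_smul, hEi j _ hx]), map_smul, hjj]
  obtain ⟨q', hq', h⟩ := hle hq
  rwa [← hinj h]

end ParabolicGeometry
end

noncomputable section

/-! ### Lie brackets as commutators of derivations -/

section BracketDerivation

open Set Filter Topology VectorField

variable {E : Type*} [NormedAddCommGroup E] [NormedSpace ℝ E]
  {H : Type*} [TopologicalSpace H] {I : ModelWithCorners ℝ E H} [I.Boundaryless]
  {M : Type*} [TopologicalSpace M] [ChartedSpace H M]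
  {F : Type*} [NormedAddCommGroup F] [NormedSpace ℝ F]

variable (I) in
/-- A vector field in the preferred chart at `x`. -/
def chartField (x : M) (W : ∀ y : M, TangentSpace I y) : E → E :=
  mpullbackWithin 𝓘(ℝ, E) I (extChartAt I x).symm W (range I)

theorem mvfderiv_apply_eq_fderiv {f : M → F} {x : M} (hf : MDifferentiableAt I 𝓘(ℝ, F) f x) (v : E) :
    mvfderiv I f x v = fderiv ℝ (f ∘ (extChartAt I x).symm) (extChartAt I x x) v := by
  rw [hf.mvfderiv, I.range_eq_univ, fderivWithin_univ]
  rfl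

theorem contDiffAt_comp_extChartAt_symm {f : M → F} {x : M} {n : ℕ∞ω}
    (hf : ContMDiffAt I 𝓘(ℝ, F) n f x) :
    ContDiffAt ℝ n (f ∘ (extChartAt I x).symm) (extChartAt I x x) := by
  have := (contMDiffAt_iff.1 hf).2
  rw [I.range_eq_univ, contDiffWithinAt_univ] at this
  exact this

theorem mdifferentiableAt_of_differentiableAt_comp_extChartAt_symm {f : M → F} {x : M}
    (hf : DifferentiableAt ℝ (f ∘ (extChartAt I x).symm) (extChartAt I x x)) :
    MDifferentiableAt I 𝓘(ℝ, F) f x := by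
  rw [mdifferentiableAt_iff]
  refine ⟨?_, ?_⟩
  · have h1 : ContinuousAt ((f ∘ (extChartAt I x).symm) ∘ extChartAt I x) x :=
      hf.continuousAt.comp (continuousAt_extChartAt x)
    refine h1.congr ?_
    filter_upwards [extChartAt_source_mem_nhds (I := I) x] with y hy
    simp only [Function.comp_apply, (extChartAt I x).left_inv hy]
  · rw [I.range_eq_univ, differentiableWithinAt_univ]
    exact hf

omit [I.Boundaryless] in
theorem tendsto_extChartAt_symm (x : M) :
    Tendsto (extChartAt I x).symm (𝓝 (extChartAt I x x)) (𝓝 x) := by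
  have := (continuousAt_extChartAt_symm (I := I) x).tendsto
  rwa [extChartAt_to_inv] at this

section

variable [IsManifold I 2 M]

omit [I.Boundaryless] in
theorem chartField_apply_self (x : M) (U : ∀ y : M, TangentSpace I y) :
    chartField I x U (extChartAt I x x) = U x := by
  rw [chartField, mpullbackWithin_apply, extChartAt_to_inv]
  exact mfderivWithin_extChartAt_symm_inverse_apply (v := U x)

theorem differentiableAt_chartField [CompleteSpace E] {x : M} {U : ∀ y : M, TangentSpace I y}
    (hU : MDifferentiableAt I I.tangent (fun y => (⟨y, U y⟩ : TangentBundle I M)) x) :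
    DifferentiableAt ℝ (chartField I x U) (extChartAt I x x) := by
  have := (mdifferentiableWithinAt_univ.2 hU).differentiableWithinAt_mpullbackWithin_vectorField
  rw [preimage_univ, univ_inter] at this
  unfold chartField
  convert! this.differentiableAt (by rw [I.range_eq_univ]; exact univ_mem)

/-- At the centre of its own chart a tangent space is identified with the model space, the
derivative of the chart being the identity; no correction factor remains. -/
theorem mlieBracket_eq_lieBracket_chartField (x : M) (V W : ∀ y : M, TangentSpace I y) :
    mlieBracket I V W x =
      lieBracket ℝ (chartField I x V) (chartField I x W) (extChartAt I x x) := by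
  rw [← mlieBracketWithin_univ, mlieBracketWithin_apply]
  have h1 : ∀ v : E, (mfderiv I 𝓘(ℝ, E) (extChartAt I x) x).inverse v = v := by
    intro v
    rw [mfderiv_extChartAt_self]
    exact congrArg (fun T : E →L[ℝ] E => T v) ContinuousLinearMap.inverse_id
  refine (h1 _).trans ?_
  have h2 : ∀ V W : E → E, lieBracketWithin ℝ V W (range I) = lieBracket ℝ V W := by
    intro V W
    rw [I.range_eq_univ, lieBracketWithin_univ]
  rw [preimage_univ, univ_inter]
  exact congrFun (h2 _ _) _

/-- The derivative of a function along a vector field, in a chart. -/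
theorem eventually_mvfderiv_apply_eq {f : M → F} {x : M}
    (hf : ContMDiffAt I 𝓘(ℝ, F) 2 f x) (W : ∀ y : M, TangentSpace I y) :
    ∀ᶠ y in 𝓝 (extChartAt I x x),
      mvfderiv I f ((extChartAt I x).symm y) (W ((extChartAt I x).symm y))
      = fderiv ℝ (f ∘ (extChartAt I x).symm) y (chartField I x W y) := by
  have h1 : ∀ᶠ y in 𝓝 x, MDifferentiableAt I 𝓘(ℝ, F) f y :=
    ((contMDiffAt_iff_contMDiffAt_nhds (by simp)).1 (hf.of_le one_le_two)).mono
      fun y hy => hy.mdifferentiableAt one_ne_zero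
  filter_upwards [(tendsto_extChartAt_symm (I := I) x).eventually h1,
    extChartAt_target_mem_nhds (I := I) x] with y hy hyt
  have h3 : MDifferentiableAt 𝓘(ℝ, E) I (extChartAt I x).symm y := by
    have := mdifferentiableWithinAt_extChartAt_symm (I := I) hyt
    rwa [I.range_eq_univ, mdifferentiableWithinAt_univ] at this
  have h4 := mfderiv_comp y hy h3
  rw [mfderiv_eq_fderiv] at h4
  have h5 := isInvertible_mfderivWithin_extChartAt_symm (I := I) hyt
  rw [I.range_eq_univ, mfderivWithin_univ] at h5
  rw [chartField, mpullbackWithin_apply, I.range_eq_univ, mfderivWithin_univ]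
  have h6 := congrArg (fun T => T ((mfderiv 𝓘(ℝ, E) I (extChartAt I x).symm y).inverse
    (W ((extChartAt I x).symm y)))) h4
  refine Eq.trans ?_ h6.symm
  change _ = mfderiv I 𝓘(ℝ, F) f _ (mfderiv 𝓘(ℝ, E) I (extChartAt I x).symm y
    ((mfderiv 𝓘(ℝ, E) I (extChartAt I x).symm y).inverse (W ((extChartAt I x).symm y))))
  rw [h5.self_apply_inverse]
  rfl

variable [CompleteSpace E]

/-- The derivative of a `C²` function along a differentiable vector field is differentiable. -/
theorem mdifferentiableAt_mvfderiv_apply {f : M → F} {x : M}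
    (hf : ContMDiffAt I 𝓘(ℝ, F) 2 f x) {W : ∀ y : M, TangentSpace I y}
    (hW : MDifferentiableAt I I.tangent (fun y => (⟨y, W y⟩ : TangentBundle I M)) x) :
    MDifferentiableAt I 𝓘(ℝ, F) (fun y => mvfderiv I f y (W y)) x := by
  refine mdifferentiableAt_of_differentiableAt_comp_extChartAt_symm ?_
  have h1 : DifferentiableAt ℝ (fderiv ℝ (f ∘ (extChartAt I x).symm)) (extChartAt I x x) :=
    ((contDiffAt_comp_extChartAt_symm hf).fderiv_right (m := 1) (by norm_num)).differentiableAt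
      one_ne_zero
  exact (h1.clm_apply (differentiableAt_chartField hW)).congr_of_eventuallyEq
    (eventually_mvfderiv_apply_eq hf W)

/-- The Lie bracket of vector fields acts on functions by the commutator. -/
theorem mvfderiv_mlieBracket {f : M → F} {x : M}
    (hf : ContMDiffAt I 𝓘(ℝ, F) 2 f x) {V W : ∀ y : M, TangentSpace I y}
    (hV : MDifferentiableAt I I.tangent (fun y => (⟨y, V y⟩ : TangentBundle I M)) x)
    (hW : MDifferentiableAt I I.tangent (fun y => (⟨y, W y⟩ : TangentBundle I M)) x) :
    mvfderiv I f x (mlieBracket I V W x) =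
      mvfderiv I (fun y => mvfderiv I f y (W y)) x (V x) -
      mvfderiv I (fun y => mvfderiv I f y (V y)) x (W x) := by
  have key : ∀ {U : ∀ y : M, TangentSpace I y}
     (_ : MDifferentiableAt I I.tangent (fun y => (⟨y, U y⟩ : TangentBundle I M)) x) (v : E),
     mvfderiv I (fun y => mvfderiv I f y (U y)) x v =
      fderiv ℝ (fun y => fderiv ℝ (f ∘ (extChartAt I x).symm) y (chartField I x U y))
        (extChartAt I x x) v := by
    intro U hU v
    refine (mvfderiv_apply_eq_fderiv (mdifferentiableAt_mvfderiv_apply hf hU) v).trans ?_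
    have : _ =ᶠ[𝓝 (extChartAt I x x)] _ := eventually_mvfderiv_apply_eq hf U
    exact congrArg (fun T : E →L[ℝ] F => T v) this.fderiv_eq
  refine ((mvfderiv_apply_eq_fderiv (hf.mdifferentiableAt two_ne_zero) _).trans ?_).trans
    (congrArg₂ (fun a b : F => a - b) (key hW (V x)) (key hV (W x))).symm
  rw [mlieBracket_eq_lieBracket_chartField,
    fderiv_apply_lieBracket (contDiffAt_comp_extChartAt_symm hf) (by simp)
      (differentiableAt_chartField hW) (differentiableAt_chartField hV),
    chartField_apply_self x V, chartField_apply_self x W]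

end

end BracketDerivation

/-! ### Mixed second derivatives -/

section MixedDerivatives

open Set Filter Topology

variable {E : Type*} [NormedAddCommGroup E] [NormedSpace ℝ E]
  {H : Type*} [TopologicalSpace H] {I : ModelWithCorners ℝ E H} [I.Boundaryless]
  {M : Type*} [TopologicalSpace M] [ChartedSpace H M] [IsManifold I 1 M]
  {E' : Type*} [NormedAddCommGroup E'] [NormedSpace ℝ E']
  {H' : Type*} [TopologicalSpace H'] {J : ModelWithCorners ℝ E' H'} [J.Boundaryless]
  {N : Type*} [TopologicalSpace N] [ChartedSpace H' N] [IsManifold J 1 N]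
  {F : Type*} [NormedAddCommGroup F] [NormedSpace ℝ F]

variable (I J) in
/-- A function of two variables in the preferred charts at a pair of points. -/
def inCharts (h : M → N → F) (x : M) (y : N) (z : E × E') : F :=
  h ((extChartAt I x).symm z.1) ((extChartAt J y).symm z.2)

omit [IsManifold I 1 M] [IsManifold J 1 N] in
theorem contDiffAt_inCharts {h : M → N → F} {x : M} {y : N} {n : ℕ∞ω}
    (hh : ContMDiffAt (I.prod J) 𝓘(ℝ, F) n (Function.uncurry h) (x, y)) :
    ContDiffAt ℝ n (inCharts I J h x y) (extChartAt I x x, extChartAt J y y) := by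
  have := contDiffAt_comp_extChartAt_symm hh
  rw [extChartAt_prod] at this
  exact this

/-- Equality on a whole neighbourhood, and not only at the base point, is what permits
differentiating once more in the other variable. -/
theorem eventually_mvfderiv_right_eq {h : M → N → F} {x : M} {y : N}
    (hh : ContMDiffAt (I.prod J) 𝓘(ℝ, F) 1 (Function.uncurry h) (x, y)) (w : E') :
    ∀ᶠ u in 𝓝 (extChartAt I x x), mvfderiv J (h ((extChartAt I x).symm u)) y w
      = fderiv ℝ (inCharts I J h x y) (u, extChartAt J y y) (0, w) := by
  have h1 : ∀ᶠ u in 𝓝 (extChartAt I x x),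
      ContMDiffAt (I.prod J) 𝓘(ℝ, F) 1 (Function.uncurry h) ((extChartAt I x).symm u, y) := by
    have ht : Tendsto (fun u => ((extChartAt I x).symm u, y)) (𝓝 (extChartAt I x x)) (𝓝 (x, y)) :=
      (tendsto_extChartAt_symm (I := I) x).prodMk_nhds tendsto_const_nhds
    exact ht.eventually ((contMDiffAt_iff_contMDiffAt_nhds (by simp)).1 hh)
  have h2 : ∀ᶠ u in 𝓝 (extChartAt I x x),
      ContDiffAt ℝ 1 (inCharts I J h x y) (u, extChartAt J y y) := by
    have ht : Tendsto (fun u => (u, extChartAt J y y)) (𝓝 (extChartAt I x x))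
        (𝓝 (extChartAt I x x, extChartAt J y y)) :=
      tendsto_id.prodMk_nhds tendsto_const_nhds
    exact ht.eventually ((contDiffAt_inCharts hh).eventually (by simp))
  filter_upwards [h1, h2] with u hu1 hu2
  have h3 : MDifferentiableAt J 𝓘(ℝ, F) (h ((extChartAt I x).symm u)) y := by
    have := hu1.mdifferentiableAt one_ne_zero
    exact MDifferentiableAt.comp (I' := I.prod J) (g := Function.uncurry h)
      (f := fun z : N => ((extChartAt I x).symm u, z)) y this
      (mdifferentiableAt_const.prodMk mdifferentiableAt_id)
  refine (mvfderiv_apply_eq_fderiv h3 w).trans ?_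
  have h4 := (hu2.differentiableAt one_ne_zero).hasFDerivAt.comp (extChartAt J y y)
    (hasFDerivAt_prodMk_right u (extChartAt J y y))
  have h5 : h ((extChartAt I x).symm u) ∘ (extChartAt J y).symm
      = inCharts I J h x y ∘ fun z => (u, z) := rfl
  rw [h5, h4.fderiv]
  simp

theorem eventually_mvfderiv_left_eq {h : M → N → F} {x : M} {y : N}
    (hh : ContMDiffAt (I.prod J) 𝓘(ℝ, F) 1 (Function.uncurry h) (x, y)) (v : E) :
    ∀ᶠ u in 𝓝 (extChartAt J y y), mvfderiv I (fun z => h z ((extChartAt J y).symm u)) x v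
      = fderiv ℝ (inCharts I J h x y) (extChartAt I x x, u) (v, 0) := by
  have h1 : ∀ᶠ u in 𝓝 (extChartAt J y y),
      ContMDiffAt (I.prod J) 𝓘(ℝ, F) 1 (Function.uncurry h) (x, (extChartAt J y).symm u) := by
    have ht : Tendsto (fun u => (x, (extChartAt J y).symm u)) (𝓝 (extChartAt J y y)) (𝓝 (x, y)) :=
      tendsto_const_nhds.prodMk_nhds (tendsto_extChartAt_symm (I := J) y)
    exact ht.eventually ((contMDiffAt_iff_contMDiffAt_nhds (by simp)).1 hh)
  have h2 : ∀ᶠ u in 𝓝 (extChartAt J y y),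
      ContDiffAt ℝ 1 (inCharts I J h x y) (extChartAt I x x, u) := by
    have ht : Tendsto (fun u => (extChartAt I x x, u)) (𝓝 (extChartAt J y y))
        (𝓝 (extChartAt I x x, extChartAt J y y)) :=
      tendsto_const_nhds.prodMk_nhds tendsto_id
    exact ht.eventually ((contDiffAt_inCharts hh).eventually (by simp))
  filter_upwards [h1, h2] with u hu1 hu2
  have h3 : MDifferentiableAt I 𝓘(ℝ, F) (fun z => h z ((extChartAt J y).symm u)) x := by
    have := hu1.mdifferentiableAt one_ne_zero
    exact MDifferentiableAt.comp (I' := I.prod J) (g := Function.uncurry h)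
      (f := fun z : M => (z, (extChartAt J y).symm u)) x this
      (mdifferentiableAt_id.prodMk mdifferentiableAt_const)
  refine (mvfderiv_apply_eq_fderiv h3 v).trans ?_
  have h4 := (hu2.differentiableAt one_ne_zero).hasFDerivAt.comp (f := fun z : E => (z, u))
    (extChartAt I x x) (hasFDerivAt_prodMk_left (𝕜 := ℝ) (extChartAt I x x) u)
  have h5 : (fun z => h z ((extChartAt J y).symm u)) ∘ (extChartAt I x).symm
      = inCharts I J h x y ∘ fun z => (z, u) := rfl
  rw [h5, h4.fderiv]
  simp

/-- Partial derivatives of a `C²` function are differentiable and mixed second derivatives agree. -/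
theorem mdifferentiableAt_mvfderiv_right {h : M → N → F} {x : M} {y : N}
    (hh : ContMDiffAt (I.prod J) 𝓘(ℝ, F) 2 (Function.uncurry h) (x, y)) (w : E') :
    MDifferentiableAt I 𝓘(ℝ, F) (fun z => mvfderiv J (h z) y w) x ∧
    ∀ v : E, mvfderiv I (fun z => mvfderiv J (h z) y w) x v =
      fderiv ℝ (fderiv ℝ (inCharts I J h x y)) (extChartAt I x x, extChartAt J y y) (v, 0) (0, w) := by
  have h1 : DifferentiableAt ℝ (fderiv ℝ (inCharts I J h x y))
      (extChartAt I x x, extChartAt J y y) :=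
    ((contDiffAt_inCharts hh).fderiv_right (m := 1) (by norm_num)).differentiableAt one_ne_zero
  have h2 : (fun z => mvfderiv J (h z) y w) ∘ (extChartAt I x).symm =ᶠ[𝓝 (extChartAt I x x)]
      fun u => fderiv ℝ (inCharts I J h x y) (u, extChartAt J y y) (0, w) :=
    eventually_mvfderiv_right_eq (hh.of_le one_le_two) w
  have h3 := (h1.hasFDerivAt.comp (f := fun z : E => (z, extChartAt J y y)) (extChartAt I x x)
    (hasFDerivAt_prodMk_left (𝕜 := ℝ) (extChartAt I x x) (extChartAt J y y))).clm_apply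
      (hasFDerivAt_const ((0, w) : E × E') (extChartAt I x x))
  have h4 := h3.congr_of_eventuallyEq h2
  have h5 := mdifferentiableAt_of_differentiableAt_comp_extChartAt_symm h4.differentiableAt
  refine ⟨h5, fun v => (mvfderiv_apply_eq_fderiv h5 v).trans ?_⟩
  rw [h4.fderiv]
  simp

theorem mdifferentiableAt_mvfderiv_left {h : M → N → F} {x : M} {y : N}
    (hh : ContMDiffAt (I.prod J) 𝓘(ℝ, F) 2 (Function.uncurry h) (x, y)) (v : E) :
    MDifferentiableAt J 𝓘(ℝ, F) (fun z => mvfderiv I (fun t => h t z) x v) y ∧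
    ∀ w : E', mvfderiv J (fun z => mvfderiv I (fun t => h t z) x v) y w =
      fderiv ℝ (fderiv ℝ (inCharts I J h x y)) (extChartAt I x x, extChartAt J y y) (0, w) (v, 0) := by
  have h1 : DifferentiableAt ℝ (fderiv ℝ (inCharts I J h x y))
      (extChartAt I x x, extChartAt J y y) :=
    ((contDiffAt_inCharts hh).fderiv_right (m := 1) (by norm_num)).differentiableAt one_ne_zero
  have h2 : (fun z => mvfderiv I (fun t => h t z) x v) ∘ (extChartAt J y).symm
      =ᶠ[𝓝 (extChartAt J y y)]
      fun u => fderiv ℝ (inCharts I J h x y) (extChartAt I x x, u) (v, 0) :=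
    eventually_mvfderiv_left_eq (hh.of_le one_le_two) v
  have h3 := (h1.hasFDerivAt.comp (extChartAt J y y)
    (hasFDerivAt_prodMk_right (extChartAt I x x) (extChartAt J y y))).clm_apply
      (hasFDerivAt_const ((v, 0) : E × E') (extChartAt J y y))
  have h4 := h3.congr_of_eventuallyEq h2
  have h5 := mdifferentiableAt_of_differentiableAt_comp_extChartAt_symm h4.differentiableAt
  refine ⟨h5, fun w => (mvfderiv_apply_eq_fderiv h5 w).trans ?_⟩
  rw [h4.fderiv]
  simp

/-- Mixed second derivatives of a `C²` function agree. -/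
theorem mvfderiv_mvfderiv_comm {h : M → N → F} {x : M} {y : N}
    (hh : ContMDiffAt (I.prod J) 𝓘(ℝ, F) 2 (Function.uncurry h) (x, y)) (v : E) (w : E') :
    mvfderiv I (fun z => mvfderiv J (h z) y w) x v =
      mvfderiv J (fun z => mvfderiv I (fun t => h t z) x v) y w := by
  rw [(mdifferentiableAt_mvfderiv_right hh w).2, (mdifferentiableAt_mvfderiv_left hh v).2]
  exact (contDiffAt_inCharts hh).isSymmSndFDerivAt (by simp) _ _

end MixedDerivatives
end

noncomputable section

/-! ### Brackets from families of vector fields permuted by an action -/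

section RightTranslations

open Set Filter Topology VectorField

variable {E : Type*} [NormedAddCommGroup E] [NormedSpace ℝ E]
  {H : Type*} [TopologicalSpace H] {I : ModelWithCorners ℝ E H} [I.Boundaryless]
  {M : Type*} [TopologicalSpace M] [ChartedSpace H M]
  {E' : Type*} [NormedAddCommGroup E'] [NormedSpace ℝ E']
  {H' : Type*} [TopologicalSpace H'] {J : ModelWithCorners ℝ E' H'} [J.Boundaryless]
  {N : Type*} [TopologicalSpace N] [ChartedSpace H' N]
  {F : Type*} [NormedAddCommGroup F] [NormedSpace ℝ F]
  {F' : Type*} [NormedAddCommGroup F'] [NormedSpace ℝ F']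

theorem hasFDerivAt_comp_extChartAt_symm {f : N → F} {y : N}
    (hf : MDifferentiableAt J 𝓘(ℝ, F) f y) :
    HasFDerivAt (f ∘ (extChartAt J y).symm)
      (fderiv ℝ (f ∘ (extChartAt J y).symm) (extChartAt J y y)) (extChartAt J y y) := by
  have := (mdifferentiableAt_iff f y).1 hf
  rw [J.range_eq_univ, differentiableWithinAt_univ] at this
  exact this.2.hasFDerivAt

/-- The derivative of `∑ i, qᵢ • gᵢ` at a common zero of the `qᵢ`. -/
theorem mvfderiv_sum_smul_of_eq_zero {ι : Type*} [Fintype ι] {q : ι → N → ℝ} {g : ι → N → F}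
    {y : N} (hq : ∀ i, MDifferentiableAt J 𝓘(ℝ, ℝ) (q i) y)
    (hg : ∀ i, MDifferentiableAt J 𝓘(ℝ, F) (g i) y) (h0 : ∀ i, q i y = 0) :
    MDifferentiableAt J 𝓘(ℝ, F) (fun z => ∑ i, q i z • g i z) y ∧ ∀ w : E',
    mvfderiv J (fun z => ∑ i, q i z • g i z) y w = ∑ i, (mvfderiv J (q i) y w : ℝ) • g i y := by
  have h1 := HasFDerivAt.fun_sum (u := Finset.univ) fun i _ =>
    (hasFDerivAt_comp_extChartAt_symm (hq i)).smul (hasFDerivAt_comp_extChartAt_symm (hg i))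
  have h2 : (fun z => ∑ i, q i z • g i z) ∘ (extChartAt J y).symm = fun z =>
    ∑ i, (q i ∘ (extChartAt J y).symm • g i ∘ (extChartAt J y).symm) z := rfl
  have h3 : MDifferentiableAt J 𝓘(ℝ, F) (fun z => ∑ i, q i z • g i z) y :=
    mdifferentiableAt_of_differentiableAt_comp_extChartAt_symm (by
      rw [h2]; exact h1.differentiableAt)
  refine ⟨h3, fun w => (mvfderiv_apply_eq_fderiv h3 w).trans ?_⟩
  rw [h2, h1.fderiv, sum_apply]
  refine Finset.sum_congr rfl fun i _ => ?_
  rw [mvfderiv_apply_eq_fderiv (hq i)]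
  simp [h0]

theorem mvfderiv_clm_comp (T : F →L[ℝ] F') {f : N → F} {y : N}
    (hf : MDifferentiableAt J 𝓘(ℝ, F) f y) :
    MDifferentiableAt J 𝓘(ℝ, F') (fun z => T (f z)) y ∧
    ∀ w : E', mvfderiv J (fun z => T (f z)) y w = T (mvfderiv J f y w) := by
  have h1 := T.hasFDerivAt.comp _ (hasFDerivAt_comp_extChartAt_symm hf)
  have h2 : (fun z => T (f z)) ∘ (extChartAt J y).symm = T ∘ (f ∘ (extChartAt J y).symm) := rfl
  have h3 : MDifferentiableAt J 𝓘(ℝ, F') (fun z => T (f z)) y :=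
    mdifferentiableAt_of_differentiableAt_comp_extChartAt_symm (by
      rw [h2]; exact h1.differentiableAt)
  refine ⟨h3, fun w => (mvfderiv_apply_eq_fderiv h3 w).trans ?_⟩
  rw [h2, h1.fderiv, mvfderiv_apply_eq_fderiv hf]
  rfl

omit [I.Boundaryless] in
theorem mvfderiv_extChartAt_of_eq [IsManifold I 1 M] {x y : M} (h : y = x) (v : E) :
    mvfderiv I (extChartAt I x) y v = v := by
  subst h
  have := mfderiv_extChartAt_self (I := I) (x := y)
  exact congrArg (fun T : E →L[ℝ] E => T v) this

omit [I.Boundaryless] in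
theorem mvfderiv_congr_of_eventuallyEq {f g : M → F} {x : M} (h : f =ᶠ[𝓝 x] g) (v : E) :
    mvfderiv I f x v = mvfderiv I g x v :=
  congrArg (fun T : E →L[ℝ] F => T v) (Filter.EventuallyEq.mfderiv_eq (I := I) (I' := 𝓘(ℝ, F)) h)

omit [I.Boundaryless] [J.Boundaryless] in
theorem mvfderiv_comp_eq {f : M → F} {g : N → M} {y : N} (hf : MDifferentiableAt I 𝓘(ℝ, F) f (g y))
    (hg : MDifferentiableAt J I g y) (w : E') :
    mvfderiv J (fun z => f (g z)) y w = mvfderiv I f (g y) (mfderiv J I g y w) :=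
  congrArg (fun T : E' →L[ℝ] F => T w) (mfderiv_comp y hf hg)

/-- Let `act : M → N → M` have the identity as its partial map at `p₀`, let `U` be its derivative
in the direction `Y` of `N` at `p₀`, and let `W` be a linear family of vector fields that is
permuted by the maps `act · p`. Then the bracket of `U` with a field of the family is the field
of the family given by the derivative of the permutation. -/
theorem mlieBracket_eq_neg_of_mfderiv_act [CompleteSpace E] [IsManifold I 2 M] [IsManifold J 2 N]
    {act : M → N → M}
    (hact : ContMDiff (I.prod J) I 2 (fun z : M × N => act z.1 z.2)) {p₀ : N}
    (hact₀ : ∀ b, act b p₀ = b) {b : M} {Y : E'} {U : ∀ b : M, TangentSpace I b}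
    (hU : MDifferentiableAt I I.tangent (fun y => (⟨y, U y⟩ : TangentBundle I M)) b)
    (hUY : ∀ b, (U b : E) = (mfderiv J I (act b) p₀ Y : E))
    {K : Type*} [NormedAddCommGroup K] [NormedSpace ℝ K] [FiniteDimensional ℝ K]
    {W : ∀ b : M, K →ₗ[ℝ] TangentSpace I b}
    (hW : ∀ X, MDifferentiableAt I I.tangent (fun y => (⟨y, W y X⟩ : TangentBundle I M)) b)
    {X : K} {c : N → K} (hc : MDifferentiableAt J 𝓘(ℝ, K) c p₀) (hc₀ : c p₀ = X)
    (hWc : ∀ p, mfderiv I I (fun y => act y p) b (W b X) = W (act b p) (c p)) :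
    mlieBracket I U (fun y => W y X) b = - W b (mvfderiv J c p₀ Y) := by
  -- The chart is a vector-valued function whose derivative at b is the identity, so the bracket can
  -- be computed as a commutator of derivations applied to this one function.
  set f := extChartAt I b with hf_def
  have hf : ContMDiffAt I 𝓘(ℝ, E) 2 f b := contMDiffAt_extChartAt
  have hfe : ∀ᶠ y in 𝓝 b, MDifferentiableAt I 𝓘(ℝ, E) f y :=
    ((contMDiffAt_iff_contMDiffAt_nhds (by simp)).1 (hf.of_le one_le_two)).mono
      fun y hy => hy.mdifferentiableAt one_ne_zero
  have hactl : ∀ p y, MDifferentiableAt I I (fun y => act y p) y := fun p y =>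
    MDifferentiableAt.comp (I' := I.prod J) (g := fun z : M × N => act z.1 z.2)
      (f := fun z : M => (z, p)) y (hact.mdifferentiable two_ne_zero _)
      (mdifferentiableAt_id.prodMk mdifferentiableAt_const)
  have hactr : ∀ y p, MDifferentiableAt J I (act y) p := fun y p =>
    MDifferentiableAt.comp (I' := I.prod J) (g := fun z : M × N => act z.1 z.2)
      (f := fun z : N => (y, z)) p (hact.mdifferentiable two_ne_zero _)
      (mdifferentiableAt_const.prodMk mdifferentiableAt_id)
  have htend : Tendsto (act b) (𝓝 p₀) (𝓝 b) := by
    have := (hactr b p₀).continuousAt.tendsto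
    rwa [hact₀] at this
  have hh : ContMDiffAt (I.prod J) 𝓘(ℝ, E) 2 (Function.uncurry fun y p => f (act y p)) (b, p₀) := by
    refine ContMDiffAt.comp (g := f) (f := fun z : M × N => act z.1 z.2) (b, p₀) ?_
      hact.contMDiffAt
    simp only [hact₀]
    exact hf
  have hWd : ∀ X, MDifferentiableAt I 𝓘(ℝ, E) (fun y => mvfderiv I f y (W y X)) b := fun X =>
    mdifferentiableAt_mvfderiv_apply hf (hW X)
  have hWp : ∀ X, MDifferentiableAt J 𝓘(ℝ, E)
      (fun p => mvfderiv I f (act b p) (W (act b p) X)) p₀ := fun X => by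
    refine MDifferentiableAt.comp (I' := I) (g := fun y => mvfderiv I f y (W y X))
      (f := act b) p₀ ?_ (hactr b p₀)
    rw [hact₀]
    exact hWd X
  -- the derivative of `W X` along `U`
  have h1 : mvfderiv I (fun y => mvfderiv I f y (W y X)) b (U b)
      = mvfderiv J (fun p => mvfderiv I f (act b p) (W (act b p) X)) p₀ Y := by
    have := mvfderiv_comp_eq (J := J) (f := fun y => mvfderiv I f y (W y X)) (g := act b) (y := p₀)
      (by rw [hact₀]; exact hWd X) (hactr b p₀) Y
    rw [this]
    have h : ∀ y, y = b → ∀ u : E, mvfderiv I (fun y => mvfderiv I f y (W y X)) b u =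
      mvfderiv I (fun y => mvfderiv I f y (W y X)) y u := by
      rintro y rfl u; rfl
    refine (congrArg (mvfderiv I (fun y => mvfderiv I f y (W y X)) b) (hUY b)).trans ?_
    exact h _ (hact₀ b) _
  -- the derivative of `U` along `W X`
  have h2 : mvfderiv I (fun y => mvfderiv I f y (U y)) b (W b X)
      = mvfderiv J (fun p => mvfderiv I f (act b p) (W (act b p) (c p))) p₀ Y := by
    have h3 : (fun y => mvfderiv I f y (U y)) =ᶠ[𝓝 b]
        fun y => mvfderiv J (fun p => f (act y p)) p₀ Y := by
      filter_upwards [hfe] with y hy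
      have := mvfderiv_comp_eq (J := J) (f := f) (g := act y) (y := p₀)
        (by rw [hact₀]; exact hy) (hactr y p₀) Y
      rw [this]
      have h : ∀ z, z = y → ∀ u : E, mvfderiv I f y u = mvfderiv I f z u := by
        rintro z rfl u; rfl
      refine (congrArg (mvfderiv I f y) (hUY y)).trans ?_
      exact h _ (hact₀ y) _
    refine (mvfderiv_congr_of_eventuallyEq h3 _).trans ?_
    -- U is itself a derivative in p, so U f is a partial derivative of f(act y p). Differentiating
    -- first in y instead moves W X along the action and turns it into W (c p).
    refine (mvfderiv_mvfderiv_comm hh _ _).trans ?_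
    refine mvfderiv_congr_of_eventuallyEq ?_ _
    filter_upwards [htend.eventually hfe] with p hp
    rw [← hWc]
    exact mvfderiv_comp_eq (J := I) (f := f) (g := fun y => act y p) (y := b) hp (hactl p b) _
  have hinj : ∀ v : E, mvfderiv I f b v = v := mvfderiv_extChartAt_of_eq rfl
  have hbr := mvfderiv_mlieBracket hf hU (hW X)
  rw [h1, h2] at hbr
  -- The two terms of the commutator differ by the derivative of p ↦ W(X - c p). In a basis the
  -- coefficients of X - c p vanish at p₀, so the product rule only sees their derivatives, and the
  -- derivatives of the fields drop out.
  let B := Module.finBasis ℝ K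
  have hexp : ∀ p, mvfderiv I f (act b p) (W (act b p) (c p)) =
      mvfderiv I f (act b p) (W (act b p) X) -
      ∑ i, B.repr (X - c p) i • mvfderiv I f (act b p) (W (act b p) (B i)) := by
    intro p
    have h4 : c p = X - ∑ i, B.repr (X - c p) i • B i := by
      rw [B.sum_repr]; abel
    conv_lhs => rw [h4]
    simp only [map_sub, map_sum, map_smul]
  let T : Fin (Module.finrank ℝ K) → K →L[ℝ] ℝ := fun i => LinearMap.toContinuousLinearMap (B.coord i)
  have hcX : MDifferentiableAt J 𝓘(ℝ, K) (fun p => X - c p) p₀ := mdifferentiableAt_const.sub hc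
  have hdX : ∀ w : E', mvfderiv J (fun p => X - c p) p₀ w = - mvfderiv J c p₀ w := by
    intro w
    have h := congrArg (fun T : E' →L[ℝ] K => T w)
      (mvfderiv_sub (I := J) (mdifferentiableAt_const (c := X)) hc)
    refine h.trans ?_
    change (mvfderiv J (fun _ => X) p₀ - mvfderiv J c p₀) w = _
    rw [mvfderiv_const]
    exact zero_sub _
  have hq : ∀ i, MDifferentiableAt J 𝓘(ℝ, ℝ) (fun p => B.repr (X - c p) i) p₀ := fun i =>
    (mvfderiv_clm_comp (T i) hcX).1
  have hq' : ∀ i, mvfderiv J (fun p => B.repr (X - c p) i) p₀ Y = -B.repr (mvfderiv J c p₀ Y) i := by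
    intro i
    refine ((mvfderiv_clm_comp (T i) hcX).2 Y).trans ?_
    rw [hdX, map_neg]
    rfl
  obtain ⟨hs, hs'⟩ := mvfderiv_sum_smul_of_eq_zero hq (fun i => hWp (B i)) (by simp [hc₀])
  have h5 : mvfderiv J (fun p => mvfderiv I f (act b p) (W (act b p) (c p))) p₀ Y =
      mvfderiv J (fun p => mvfderiv I f (act b p) (W (act b p) X)) p₀ Y -
      ∑ i, (-B.repr (mvfderiv J c p₀ Y) i) • mvfderiv I f (act b p₀) (W (act b p₀) (B i)) := by
    simp only [← hq']
    rw [funext hexp, ← hs' Y]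
    exact congrArg (fun T : E' →L[ℝ] E => T Y) (mvfderiv_sub (I := J) (hWp X) hs)
  rw [h5, sub_sub_cancel, hact₀] at hbr
  have h6 : W b (mvfderiv J c p₀ Y) = ∑ i, B.repr (mvfderiv J c p₀ Y) i • W b (B i) := by
    conv_lhs => rw [← B.sum_repr (mvfderiv J c p₀ Y)]
    simp only [map_sum, map_smul]
  refine ((hinj _).symm.trans hbr).trans ?_
  rw [h6, ← Finset.sum_neg_distrib]
  refine Finset.sum_congr rfl fun i _ => ?_
  rw [neg_smul]
  exact congrArg (fun v : E => -(B.repr (mvfderiv J c p₀ Y) i • v)) (hinj _)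

end RightTranslations
end

noncomputable section

namespace ParabolicGeometry

/-- Tangent vectors at different points are identified with vectors of the model space. -/
theorem mfderiv_apply_congr_point {E E' : Type*} [NormedAddCommGroup E] [NormedSpace ℝ E]
    [NormedAddCommGroup E'] [NormedSpace ℝ E'] {H H' : Type*} [TopologicalSpace H]
    [TopologicalSpace H'] {I : ModelWithCorners ℝ E H} {J : ModelWithCorners ℝ E' H'}
    {M N : Type*} [TopologicalSpace M] [ChartedSpace H M] [TopologicalSpace N] [ChartedSpace H' N]
    {f : M → N} {x y : M} (h : x = y) (v : E) :
    (mfderiv I J f x v : E') = mfderiv I J f y v := by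
  subst h; rfl

/-! ### The adjoint action and its derivative -/

section AdjointAction

open Set Filter Topology VectorField

variable {n : ℕ} {G : Type*} [TopologicalSpace G] [ChartedSpace (EuclideanSpace ℝ (Fin n)) G]
  [Group G] [LieGroup (𝓡 n) ∞ G]

theorem mdifferentiable_mul_mul (g h : G) :
    MDifferentiable (𝓡 n) (𝓡 n) (fun x : G => g * x * h) :=
  ((contMDiff_const.mul contMDiff_id).mul contMDiff_const :
    ContMDiff (𝓡 n) (𝓡 n) ∞ (fun x : G => g * x * h)).mdifferentiable (by simp)

theorem mdifferentiable_mul_left' (g : G) : MDifferentiable (𝓡 n) (𝓡 n) (fun x : G => g * x) :=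
  (contMDiff_mul_left (n := ∞)).mdifferentiable (by simp)

theorem mdifferentiable_mul_right' (g : G) : MDifferentiable (𝓡 n) (𝓡 n) (fun x : G => x * g) :=
  (contMDiff_mul_right (n := ∞)).mdifferentiable (by simp)

omit [LieGroup (𝓡 n) ∞ G] in
theorem adjoint_one (X : GroupLieAlgebra (𝓡 n) G) : adjoint (1 : G) X = X := by
  have h : (fun x : G => 1 * x * 1⁻¹) = id := by ext; simp
  have h2 := mfderiv_id (I := 𝓡 n) (x := (1 : G))
  rw [← h] at h2
  exact congrArg (fun T : EuclideanSpace ℝ (Fin n) →L[ℝ] EuclideanSpace ℝ (Fin n) => T X) h2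

theorem adjoint_mul (g h : G) (X : GroupLieAlgebra (𝓡 n) G) :
    adjoint (g * h) X = adjoint g (adjoint h X) := by
  have h1 : (fun x : G => g * h * x * (g * h)⁻¹) =
      (fun x : G => g * x * g⁻¹) ∘ fun x : G => h * x * h⁻¹ := by
    ext; simp [mul_assoc]
  have h2 := mfderiv_comp (I := 𝓡 n) (I' := 𝓡 n) (I'' := 𝓡 n) (1 : G)
    (mdifferentiable_mul_mul g g⁻¹ (h * 1 * h⁻¹)) (mdifferentiable_mul_mul h h⁻¹ 1)
  rw [← h1] at h2
  refine (congrArg (fun T : EuclideanSpace ℝ (Fin n) →L[ℝ] EuclideanSpace ℝ (Fin n) => T X)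
    h2).trans ?_
  exact mfderiv_apply_congr_point (f := fun x : G => g * x * g⁻¹) (by simp) _

/-- Differentiate g x p = (g p)(p⁻¹ x p) at x = 1. This is the permutation of left-invariant fields
by right translations that the general bracket formula requires. -/
theorem mfderiv_mul_right_mulInvariantVectorField (g p : G) (X : GroupLieAlgebra (𝓡 n) G) :
    mfderiv (𝓡 n) (𝓡 n) (fun x : G => x * p) g (mulInvariantVectorField X g) =
      mulInvariantVectorField (adjoint p⁻¹ X) (g * p) := by
  have h1 : (fun x : G => x * p) ∘ (fun x : G => g * x) =
      (fun x : G => g * p * x) ∘ (fun x : G => p⁻¹ * x * p⁻¹⁻¹) := by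
    ext; simp [mul_assoc]
  have h2 := mfderiv_comp (I := 𝓡 n) (I' := 𝓡 n) (I'' := 𝓡 n) (1 : G)
    (mdifferentiable_mul_right' p (g * 1)) (mdifferentiable_mul_left' g 1)
  have h3 := mfderiv_comp (I := 𝓡 n) (I' := 𝓡 n) (I'' := 𝓡 n) (1 : G)
    (mdifferentiable_mul_left' (g * p) (p⁻¹ * 1 * p⁻¹⁻¹)) (mdifferentiable_mul_mul p⁻¹ p⁻¹⁻¹ 1)
  rw [h1, h3] at h2
  have h4 := congrArg
    (fun T : EuclideanSpace ℝ (Fin n) →L[ℝ] EuclideanSpace ℝ (Fin n) => T X) h2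
  refine (mfderiv_apply_congr_point (f := fun x : G => x * p) (x := g)
    (y := g * 1) (by simp) _).trans
    (h4.symm.trans ?_)
  exact mfderiv_apply_congr_point (f := fun x : G => g * p * x) (by simp) _

/-- In the chart at 1, Ad(g) X is a partial derivative in x of the smooth function g x g⁻¹ of two
variables, hence differentiable in g. -/
theorem mdifferentiableAt_adjoint (X : GroupLieAlgebra (𝓡 n) G) (g : G) :
    MDifferentiableAt (𝓡 n) 𝓘(ℝ, EuclideanSpace ℝ (Fin n))
      (fun g : G => lieCoord (adjoint g X)) g := by
  set f := extChartAt (𝓡 n) (1 : G)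
  have hf : ContMDiffAt (𝓡 n) 𝓘(ℝ, EuclideanSpace ℝ (Fin n)) 2 f (1 : G) := contMDiffAt_extChartAt
  have hh : ContMDiffAt ((𝓡 n).prod (𝓡 n)) 𝓘(ℝ, EuclideanSpace ℝ (Fin n)) 2
      (Function.uncurry fun x g : G => f (g * x * g⁻¹)) (1, g) := by
    refine ContMDiffAt.comp (I' := 𝓡 n) (g := f)
      (f := fun z : G × G => z.2 * z.1 * z.2⁻¹) (1, g) ?_ ?_
    · simpa using hf
    · have : ContMDiff ((𝓡 n).prod (𝓡 n)) (𝓡 n) ∞ (fun z : G × G => z.2 * z.1 * z.2⁻¹) :=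
        (contMDiff_snd.mul contMDiff_fst).mul contMDiff_snd.inv
      exact (this.of_le ENat.LEInfty.out).contMDiffAt
  have h1 := (mdifferentiableAt_mvfderiv_left hh X).1
  have h3 : (fun g : G => lieCoord (adjoint g X)) =
      fun z => mvfderiv (𝓡 n) (fun t => f (z * t * z⁻¹)) 1 X := funext fun z => ?_
  · rw [h3]; exact h1
  have hz : z * 1 * z⁻¹ = 1 := by simp
  have h2 := mvfderiv_comp_eq (J := 𝓡 n) (f := f) (g := fun x : G => z * x * z⁻¹) (y := 1)
    (by rw [hz]; exact hf.mdifferentiableAt two_ne_zero) (mdifferentiable_mul_mul z z⁻¹ 1) X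
  refine Eq.trans ?_ h2.symm
  exact (mvfderiv_extChartAt_of_eq hz _).symm

theorem mdifferentiableAt_adjoint_inv (X : GroupLieAlgebra (𝓡 n) G) (g : G) :
    MDifferentiableAt (𝓡 n) 𝓘(ℝ, EuclideanSpace ℝ (Fin n))
      (fun g : G => lieCoord (adjoint g⁻¹ X)) g :=
  MDifferentiableAt.comp (I' := 𝓡 n) (g := fun g : G => lieCoord (adjoint g X))
    (f := fun g : G => g⁻¹) g (mdifferentiableAt_adjoint X g⁻¹)
    ((contMDiff_inv (𝓡 n) ∞).mdifferentiable (by simp) g)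

/-- The derivative of `p ↦ Ad(p⁻¹) X` at `1` is `Y ↦ -[Y, X]`. -/
theorem mvfderiv_adjoint_inv (X Y : GroupLieAlgebra (𝓡 n) G) :
    mvfderiv (𝓡 n) (fun g : G => lieCoord (adjoint g⁻¹ X)) 1 Y = lieCoord (-⁅Y, X⁆) := by
  have h1 : ∀ v : EuclideanSpace ℝ (Fin n),
      (mulInvariantVectorField (I := 𝓡 n) (G := G) v 1 : EuclideanSpace ℝ (Fin n)) = v := by
    intro v
    have h : (fun x : G => 1 * x) = id := by ext; simp
    have h2 := mfderiv_id (I := 𝓡 n) (x := (1 : G))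
    rw [← h] at h2
    exact congrArg (fun T : EuclideanSpace ℝ (Fin n) →L[ℝ] EuclideanSpace ℝ (Fin n) => T v) h2
  -- The bracket of Lie(G) is that of left-invariant fields, which are both the generators of right
  -- translations and a family permuted by them.
  have h2 := mlieBracket_eq_neg_of_mfderiv_act (I := 𝓡 n) (J := 𝓡 n) (M := G) (N := G)
    (act := fun x y => x * y) (p₀ := 1) (b := 1) (Y := Y) (U := mulInvariantVectorField Y)
    ((contMDiff_mul (𝓡 n) ∞).of_le ENat.LEInfty.out) (by simp)
    (mdifferentiableAt_mulInvariantVectorField Y) (fun _ => rfl)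
    (K := EuclideanSpace ℝ (Fin n))
    (W := fun g => (mfderiv (𝓡 n) (𝓡 n) (fun x : G => g * x) 1 :
      EuclideanSpace ℝ (Fin n) →L[ℝ] EuclideanSpace ℝ (Fin n)).toLinearMap)
    (fun X => mdifferentiableAt_mulInvariantVectorField X) (X := X)
    (c := fun g => lieCoord (adjoint g⁻¹ X)) (mdifferentiableAt_adjoint_inv X 1)
    (by simp only [inv_one]; exact adjoint_one X)
    (fun p => mfderiv_mul_right_mulInvariantVectorField 1 p X)
  have h3 : (⁅Y, X⁆ : GroupLieAlgebra (𝓡 n) G) =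
      - (mvfderiv (𝓡 n) (fun g : G => lieCoord (adjoint g⁻¹ X)) 1 Y : EuclideanSpace ℝ (Fin n)) :=
    h2.trans (congrArg (fun v : EuclideanSpace ℝ (Fin n) => -v) (h1 _))
  rw [h3]
  exact (neg_neg _).symm

/-- The adjoint action is by Lie algebra homomorphisms. -/
theorem adjoint_lie (g : G) (Y X : GroupLieAlgebra (𝓡 n) G) :
    adjoint g ⁅Y, X⁆ = ⁅adjoint g Y, adjoint g X⁆ := by
  have hc : (1 : G) = g * 1 * g⁻¹ := by simp
  -- Differentiating Ad((g p g⁻¹)⁻¹) Ad(g) X = Ad(g) Ad(p⁻¹) X at p = 1 in the direction Y gives the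
  -- claim.
  have h1 : (fun p : G => lieCoord (adjoint (g * p * g⁻¹)⁻¹ (adjoint g X))) =
      fun p : G => adjoint g (lieCoord (adjoint p⁻¹ X)) := by
    funext p
    change adjoint (g * p * g⁻¹)⁻¹ (adjoint g X) = adjoint g (adjoint p⁻¹ X)
    rw [← adjoint_mul, ← adjoint_mul]
    congr 1
    group
  have h2 := (mvfderiv_clm_comp (J := 𝓡 n) (N := G) (F' := EuclideanSpace ℝ (Fin n))
    (adjoint g : EuclideanSpace ℝ (Fin n) →L[ℝ] EuclideanSpace ℝ (Fin n))
    (mdifferentiableAt_adjoint_inv X 1)).2 Y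
  have h3 := mvfderiv_comp_eq (I := 𝓡 n) (J := 𝓡 n)
    (f := fun p : G => lieCoord (adjoint p⁻¹ (adjoint g X))) (g := fun p : G => g * p * g⁻¹) (y := 1)
    (mdifferentiableAt_adjoint_inv _ _) (mdifferentiable_mul_mul g g⁻¹ 1) Y
  rw [h1] at h3
  have h4 : ∀ y : G, y = 1 → ∀ v : EuclideanSpace ℝ (Fin n),
      mvfderiv (𝓡 n) (fun p : G => lieCoord (adjoint p⁻¹ (adjoint g X))) y v =
      mvfderiv (𝓡 n) (fun p : G => lieCoord (adjoint p⁻¹ (adjoint g X))) 1 v := by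
    rintro y rfl v; rfl
  have h5 := (h2.symm.trans h3).trans ((h4 _ hc.symm _).trans
    (mvfderiv_adjoint_inv (adjoint g X) (adjoint g Y)))
  rw [mvfderiv_adjoint_inv] at h5
  have h6 : adjoint g (-⁅Y, X⁆) = -⁅adjoint g Y, adjoint g X⁆ := h5
  rwa [map_neg, neg_inj] at h6

/-- The adjoint action of a group element as a Lie algebra automorphism. -/
def adjointEquiv (g : G) : GroupLieAlgebra (𝓡 n) G ≃ₗ⁅ℝ⁆ GroupLieAlgebra (𝓡 n) G where
  toFun := adjoint g
  invFun := adjoint g⁻¹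
  map_add' := map_add _
  map_smul' := map_smul _
  map_lie' := adjoint_lie g _ _
  left_inv X := by rw [← adjoint_mul, inv_mul_cancel, adjoint_one]
  right_inv X := by rw [← adjoint_mul, mul_inv_cancel, adjoint_one]

variable {r : ℕ} {P : Subgroup G} [ChartedSpace (EuclideanSpace ℝ (Fin r)) P]
  [LieGroup (𝓡 r) ∞ P]

omit [LieGroup (𝓡 n) ∞ G] [LieGroup (𝓡 r) ∞ P] in
theorem IsLieSubgroup.mdifferentiable (hP : IsLieSubgroup (n := n) (r := r) P) :
    MDifferentiable (𝓡 r) (𝓡 n) (Subtype.val : P → G) :=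
  hP.1.mdifferentiable (by simp)

omit [LieGroup (𝓡 n) ∞ G] [LieGroup (𝓡 r) ∞ P] in
theorem IsLieSubgroup.lieInclusion_injective (hP : IsLieSubgroup (n := n) (r := r) P) :
    Function.Injective (lieInclusion (n := n) (r := r) P) :=
  hP.2 1

theorem IsLieSubgroup.lieInclusion_adjoint (hP : IsLieSubgroup (n := n) (r := r) P) (p : P)
    (Y : GroupLieAlgebra (𝓡 r) P) :
    lieInclusion (n := n) P (adjoint p Y) = adjoint (p : G) (lieInclusion (n := n) P Y) := by
  have h1 : (Subtype.val : P → G) ∘ (fun x : P => p * x * p⁻¹) =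
      (fun x : G => (p : G) * x * (p : G)⁻¹) ∘ (Subtype.val : P → G) := by
    ext; simp
  have h2 := mfderiv_comp (I := 𝓡 r) (I' := 𝓡 r) (I'' := 𝓡 n) (1 : P)
    (hP.mdifferentiable (p * 1 * p⁻¹)) (mdifferentiable_mul_mul p p⁻¹ 1)
  have h3 := mfderiv_comp (I := 𝓡 r) (I' := 𝓡 n) (I'' := 𝓡 n) (1 : P)
    (mdifferentiable_mul_mul (p : G) (p : G)⁻¹ _) (hP.mdifferentiable 1)
  rw [h1, h3] at h2
  have h4 := congrArg
    (fun T : EuclideanSpace ℝ (Fin r) →L[ℝ] EuclideanSpace ℝ (Fin n) => T Y) h2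
  exact (mfderiv_apply_congr_point (f := (Subtype.val : P → G)) (x := 1) (y := p * 1 * p⁻¹)
    (by simp) _).trans h4.symm

omit [LieGroup (𝓡 r) ∞ P] in
/-- The derivative of `p ↦ Ad(p⁻¹) X`, restricted to a Lie subgroup. -/
theorem IsLieSubgroup.mvfderiv_adjoint_inv (hP : IsLieSubgroup (n := n) (r := r) P)
    (X : GroupLieAlgebra (𝓡 n) G) :
    MDifferentiableAt (𝓡 r) 𝓘(ℝ, EuclideanSpace ℝ (Fin n))
      (fun p : P => lieCoord (adjoint (p : G)⁻¹ X)) 1 ∧ ∀ Y : GroupLieAlgebra (𝓡 r) P,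
    mvfderiv (𝓡 r) (fun p : P => lieCoord (adjoint (p : G)⁻¹ X)) 1 Y =
      lieCoord (-⁅lieInclusion (n := n) P Y, X⁆) := by
  refine ⟨MDifferentiableAt.comp (I' := 𝓡 n) (g := fun g : G => lieCoord (adjoint g⁻¹ X))
    (f := (Subtype.val : P → G)) 1 (mdifferentiableAt_adjoint_inv X _) (hP.mdifferentiable 1),
    fun Y => ?_⟩
  have h := mvfderiv_comp_eq (I := 𝓡 n) (J := 𝓡 r)
    (f := fun g : G => lieCoord (adjoint g⁻¹ X)) (g := (Subtype.val : P → G)) (y := 1)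
    (mdifferentiableAt_adjoint_inv X _) (hP.mdifferentiable 1) Y
  exact h.trans (ParabolicGeometry.mvfderiv_adjoint_inv X (lieInclusion (n := n) P Y))

end AdjointAction

end ParabolicGeometry
end

noncomputable section

/-! ### Product rule for operator-valued functions -/

section ProductRule

variable {E' : Type*} [NormedAddCommGroup E'] [NormedSpace ℝ E']
  {H' : Type*} [TopologicalSpace H'] {J : ModelWithCorners ℝ E' H'} [J.Boundaryless]
  {N : Type*} [TopologicalSpace N] [ChartedSpace H' N]
  {F : Type*} [NormedAddCommGroup F] [NormedSpace ℝ F]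
  {F' : Type*} [NormedAddCommGroup F'] [NormedSpace ℝ F']

theorem mvfderiv_clm_apply {T : N → F →L[ℝ] F'} {f : N → F} {y : N}
    (hT : MDifferentiableAt J 𝓘(ℝ, F →L[ℝ] F') T y) (hf : MDifferentiableAt J 𝓘(ℝ, F) f y) :
    MDifferentiableAt J 𝓘(ℝ, F') (fun z => T z (f z)) y ∧
    ∀ w : E', mvfderiv J (fun z => T z (f z)) y w =
      mvfderiv J T y w (f y) + T y (mvfderiv J f y w) := by
  have h1 := (hasFDerivAt_comp_extChartAt_symm hT).clm_apply (hasFDerivAt_comp_extChartAt_symm hf)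
  have h2 : (fun z => T z (f z)) ∘ (extChartAt J y).symm =
    fun z => (T ∘ (extChartAt J y).symm) z ((f ∘ (extChartAt J y).symm) z) := rfl
  have h3 : MDifferentiableAt J 𝓘(ℝ, F') (fun z => T z (f z)) y :=
    mdifferentiableAt_of_differentiableAt_comp_extChartAt_symm (by
      rw [h2]; exact h1.differentiableAt)
  refine ⟨h3, fun w => (mvfderiv_apply_eq_fderiv h3 w).trans ?_⟩
  rw [h2, h1.fderiv, mvfderiv_apply_eq_fderiv hf, mvfderiv_apply_eq_fderiv hT]
  simp [add_comm]

end ProductRule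

namespace ParabolicGeometry

/-! ### The Lie algebra of a Lie subgroup -/

section Subgroup

variable {n : ℕ} {G : Type*} [TopologicalSpace G] [ChartedSpace (EuclideanSpace ℝ (Fin n)) G]
  [Group G] [LieGroup (𝓡 n) ∞ G]
  {r : ℕ} {P : Subgroup G} [ChartedSpace (EuclideanSpace ℝ (Fin r)) P]
  [LieGroup (𝓡 r) ∞ P]

/-- The inclusion of the Lie algebra of a Lie subgroup is a Lie algebra homomorphism. -/
theorem IsLieSubgroup.lieInclusion_lie (hP : IsLieSubgroup (n := n) (r := r) P)
    (W Y : GroupLieAlgebra (𝓡 r) P) :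
    lieInclusion (n := n) P ⁅W, Y⁆ = ⁅lieInclusion (n := n) P W, lieInclusion (n := n) P Y⁆ := by
  -- The inclusion intertwines the adjoint actions of P and G; differentiating this in p at 1 gives
  -- compatibility with brackets.
  have h1 : (fun p : P => lieCoord (adjoint (p : G)⁻¹ (lieInclusion (n := n) P Y))) =
      fun p : P => lieInclusion (n := n) P (lieCoord (adjoint p⁻¹ Y)) := by
    funext p
    exact (hP.lieInclusion_adjoint p⁻¹ Y).symm
  have h2 := (mvfderiv_clm_comp (J := 𝓡 r) (N := P) (F' := EuclideanSpace ℝ (Fin n))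
    (lieInclusion (n := n) P : EuclideanSpace ℝ (Fin r) →L[ℝ] EuclideanSpace ℝ (Fin n))
    (mdifferentiableAt_adjoint_inv Y 1)).2 W
  have h3 := (hP.mvfderiv_adjoint_inv (lieInclusion (n := n) P Y)).2 W
  rw [h1] at h3
  have h4 := h2.symm.trans h3
  rw [ParabolicGeometry.mvfderiv_adjoint_inv] at h4
  have h5 : lieInclusion (n := n) P (-⁅W, Y⁆) =
    -⁅lieInclusion (n := n) P W, lieInclusion (n := n) P Y⁆ := h4
  rwa [map_neg, neg_inj] at h5

end Subgroup

/-! ### Differentiating a representation of P -/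

section Representation

variable {r : ℕ} {P : Type*} [TopologicalSpace P] [ChartedSpace (EuclideanSpace ℝ (Fin r)) P]
  [Group P] {V : Type*} [NormedAddCommGroup V] [NormedSpace ℝ V] {ρ : P →* (V →L[ℝ] V)}

theorem infinitesimalAction_apply (Y : GroupLieAlgebra (𝓡 r) P) (v : V) :
    infinitesimalAction ρ Y v = mvfderiv (𝓡 r) (fun p : P => ρ p) 1 Y v := rfl

variable (ρ) in
/-- The action of `Lie(P)` on `V` as a linear map. -/
def infinitesimalActionHom : GroupLieAlgebra (𝓡 r) P →ₗ[ℝ] Module.End ℝ V where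
  toFun := infinitesimalAction ρ
  map_add' X Y := by
    ext v
    simp [infinitesimalAction_apply]
  map_smul' a X := by
    ext v
    simp [infinitesimalAction_apply]

theorem mvfderiv_representation_apply
    (hρ : ContMDiff (𝓡 r) 𝓘(ℝ, V →L[ℝ] V) ∞ (fun p : P => ρ p)) (v : V) :
    MDifferentiableAt (𝓡 r) 𝓘(ℝ, V) (fun p : P => ρ p v) 1 ∧ ∀ Y : GroupLieAlgebra (𝓡 r) P,
    mvfderiv (𝓡 r) (fun p : P => ρ p v) 1 Y = infinitesimalAction ρ Y v := by
  have h := mvfderiv_clm_apply (J := 𝓡 r) (T := fun p : P => ρ p) (f := fun _ => v) (y := 1)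
    (hρ.mdifferentiable (by simp) 1) mdifferentiableAt_const
  refine ⟨h.1, fun Y => (h.2 Y).trans ?_⟩
  rw [infinitesimalAction_apply, mvfderiv_const]
  exact (congrArg _ (map_zero _)).trans (add_zero _)

variable [LieGroup (𝓡 r) ∞ P]

/-- The derivative at x = 1 of ρ(x) ρ(p) = ρ(p) ρ(p⁻¹ x p). -/
theorem infinitesimalAction_conj
    (hρ : ContMDiff (𝓡 r) 𝓘(ℝ, V →L[ℝ] V) ∞ (fun p : P => ρ p)) (p : P)
    (Y : GroupLieAlgebra (𝓡 r) P) (v : V) :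
    infinitesimalAction ρ Y (ρ p v) = ρ p (infinitesimalAction ρ (adjoint p⁻¹ Y) v) := by
  have h1 := mvfderiv_representation_apply hρ (ρ p v)
  have h2 := mvfderiv_representation_apply hρ v
  have h3 : (fun x : P => ρ x (ρ p v)) = fun x : P => ρ p (ρ (p⁻¹ * x * p⁻¹⁻¹) v) := by
    funext x
    simp only [← mul_apply_eq_comp, ← map_mul]
    congr 2
    group
  have h4 : p⁻¹ * 1 * p⁻¹⁻¹ = 1 := by simp
  have hd : MDifferentiableAt (𝓡 r) 𝓘(ℝ, V) (fun p : P => ρ p v) (p⁻¹ * 1 * p⁻¹⁻¹) := by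
    rw [h4]; exact h2.1
  have h5 := mvfderiv_comp_eq (I := 𝓡 r) (J := 𝓡 r)
    (f := fun p : P => ρ p v) (g := fun x : P => p⁻¹ * x * p⁻¹⁻¹) (y := 1) hd
    (mdifferentiable_mul_mul p⁻¹ p⁻¹⁻¹ 1) Y
  have hd' : MDifferentiableAt (𝓡 r) 𝓘(ℝ, V) (fun x : P => ρ (p⁻¹ * x * p⁻¹⁻¹) v) 1 :=
    MDifferentiableAt.comp (I' := 𝓡 r) (g := fun p : P => ρ p v)
      (f := fun x : P => p⁻¹ * x * p⁻¹⁻¹) 1 hd (mdifferentiable_mul_mul p⁻¹ p⁻¹⁻¹ 1)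
  have h6 := (mvfderiv_clm_comp (J := 𝓡 r) (ρ p) hd').2 Y
  rw [← h3] at h6
  refine (h1.2 Y).symm.trans (h6.trans (congrArg (ρ p) (h5.trans ?_)))
  refine Eq.trans ?_ (h2.2 _)
  exact mfderiv_apply_congr_point (J := 𝓘(ℝ, V)) (f := fun p : P => ρ p v) h4 _

/-- The infinitesimal action is a Lie algebra representation. -/
theorem infinitesimalAction_lie
    (hρ : ContMDiff (𝓡 r) 𝓘(ℝ, V →L[ℝ] V) ∞ (fun p : P => ρ p))
    (W Y : GroupLieAlgebra (𝓡 r) P) :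
    infinitesimalAction ρ W * infinitesimalAction ρ Y -
      infinitesimalAction ρ Y * infinitesimalAction ρ W = infinitesimalAction ρ ⁅W, Y⁆ := by
  ext v
  let S : EuclideanSpace ℝ (Fin r) →L[ℝ] V := LinearMap.toContinuousLinearMap
    ((LinearMap.applyₗ v).comp (infinitesimalActionHom ρ) : GroupLieAlgebra (𝓡 r) P →ₗ[ℝ] V)
  have hS : ∀ Y : GroupLieAlgebra (𝓡 r) P, S (lieCoord Y) = infinitesimalAction ρ Y v := fun _ => rfl
  obtain ⟨h1, h1'⟩ := mvfderiv_clm_comp (J := 𝓡 r) S (mdifferentiableAt_adjoint_inv Y (1 : P))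
  have h2 := (mvfderiv_clm_apply (J := 𝓡 r) (T := fun p : P => ρ p)
    (hρ.mdifferentiable (by simp) 1) h1).2 W
  let T : V →L[ℝ] V := mvfderiv (𝓡 r) (fun p : P => ρ p) 1 Y
  obtain ⟨h3, h3'⟩ := mvfderiv_representation_apply hρ v
  have h4 := (mvfderiv_clm_comp (J := 𝓡 r) T h3).2 W
  -- Both sides of Y ρ(p) v = ρ(p) (Ad(p⁻¹) Y) v are now differentiated at p = 1 along W, which
  -- yields Y W v = W Y v - [W, Y] v.
  have h5 : (fun p : P => T (ρ p v)) = fun p : P => ρ p (S (lieCoord (adjoint p⁻¹ Y))) := by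
    funext p
    rw [hS]
    exact infinitesimalAction_conj hρ p Y v
  rw [h5] at h4
  have h6 := h4.symm.trans h2
  have e1 : T (mvfderiv (𝓡 r) (fun p : P => ρ p v) 1 W) =
      infinitesimalAction ρ Y (infinitesimalAction ρ W v) := congrArg T (h3' W)
  have e2 : mvfderiv (𝓡 r) (fun p : P => S (lieCoord (adjoint p⁻¹ Y))) 1 W =
      infinitesimalAction ρ (-⁅W, Y⁆) v :=
    (h1' W).trans (congrArg S (ParabolicGeometry.mvfderiv_adjoint_inv Y W))
  have e3 : S (lieCoord (adjoint (1 : P)⁻¹ Y)) = infinitesimalAction ρ Y v := by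
    rw [hS, inv_one, adjoint_one]
  have h7 : infinitesimalAction ρ Y (infinitesimalAction ρ W v) =
      infinitesimalAction ρ W (infinitesimalAction ρ Y v) +
      ρ 1 (infinitesimalAction ρ (-⁅W, Y⁆) v) :=
    e1.symm.trans (h6.trans (congrArg₂ (· + ·)
      (congrArg (mvfderiv (𝓡 r) (fun p : P => ρ p) 1 W) e3) (congrArg (ρ 1) e2)))
  rw [map_one] at h7
  have h8 : infinitesimalAction ρ (-⁅W, Y⁆) v = -infinitesimalAction ρ ⁅W, Y⁆ v := by
    change infinitesimalActionHom ρ (-⁅W, Y⁆) v = _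
    rw [map_neg]
    rfl
  rw [h8] at h7
  change infinitesimalAction ρ W (infinitesimalAction ρ Y v) -
    infinitesimalAction ρ Y (infinitesimalAction ρ W v) = _
  rw [h7]
  simp

omit [LieGroup (𝓡 r) ∞ P] in
/-- Invariant subspaces are invariant under the infinitesimal action. -/
theorem infinitesimalAction_mem_of_isCompl [FiniteDimensional ℝ V]
    (hρ : ContMDiff (𝓡 r) 𝓘(ℝ, V →L[ℝ] V) ∞ (fun p : P => ρ p)) {U W : Submodule ℝ V}
    (hUW : IsCompl U W) (hW : ∀ p, ∀ w ∈ W, ρ p w ∈ W) (Y : GroupLieAlgebra (𝓡 r) P)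
    {w : V} (hw : w ∈ W) : infinitesimalAction ρ Y w ∈ W := by
  -- W is the kernel of the projection to U, so it suffices to differentiate the constant function p
  -- ↦ T(ρ(p) w) = 0.
  let T : V →L[ℝ] U := LinearMap.toContinuousLinearMap (Submodule.projectionOnto U W hUW)
  have hT : ∀ v, T v = 0 ↔ v ∈ W := fun v => by
    rw [← Submodule.ker_projectionOnto hUW, LinearMap.mem_ker]
    rfl
  obtain ⟨h3, h3'⟩ := mvfderiv_representation_apply hρ w
  have h4 := (mvfderiv_clm_comp (J := 𝓡 r) T h3).2 Y
  have h5 : (fun p : P => T (ρ p w)) = fun _ => 0 := funext fun p => (hT _).2 (hW p w hw)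
  rw [h5, mvfderiv_const, h3'] at h4
  exact (hT _).1 h4.symm

end Representation

/-! ### Triviality of the nilradical on completely reducible representations -/

section NilradicalAction

variable {n : ℕ} {G : Type*} [TopologicalSpace G] [ChartedSpace (EuclideanSpace ℝ (Fin n)) G]
  [Group G] [LieGroup (𝓡 n) ∞ G]
  {r : ℕ} {P : Subgroup G} [ChartedSpace (EuclideanSpace ℝ (Fin r)) P]
  [LieGroup (𝓡 r) ∞ P] {V : Type*} [NormedAddCommGroup V] [NormedSpace ℝ V]
  [FiniteDimensional ℝ V] {ρ : P →* (V →L[ℝ] V)}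

instance finiteDimensional_groupLieAlgebra : FiniteDimensional ℝ (GroupLieAlgebra (𝓡 n) G) :=
  inferInstanceAs (FiniteDimensional ℝ (EuclideanSpace ℝ (Fin n)))

/-- The nilradical of a parabolic subalgebra acts by zero in completely reducible representations. -/
theorem infinitesimalAction_eq_zero_of_mem_positivePart
    [LieAlgebra.IsSemisimple ℝ (GroupLieAlgebra (𝓡 n) G)]
    {𝔭 : LieSubalgebra ℝ (GroupLieAlgebra (𝓡 n) G)} (h𝔭 : IsParabolic 𝔭)
    (𝒲 : WeylStructure 𝔭) (hP : IsLieSubgroup (n := n) (r := r) P)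
    (hP𝔭 : ∀ x : GroupLieAlgebra (𝓡 n) G,
      x ∈ 𝔭 ↔ ∃ Y : GroupLieAlgebra (𝓡 r) P, lieInclusion (n := n) P Y = x)
    (hρ : ContMDiff (𝓡 r) 𝓘(ℝ, V →L[ℝ] V) ∞ (fun p : P => ρ p))
    (hρred : IsCompletelyReducible ρ) {Y : GroupLieAlgebra (𝓡 r) P}
    (hY : lieInclusion (n := n) P Y ∈ positivePart 𝔭) : infinitesimalAction ρ Y = 0 := by
  let ι : GroupLieAlgebra (𝓡 r) P →ₗ[ℝ] GroupLieAlgebra (𝓡 n) G :=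
    (lieInclusion (n := n) P).toLinearMap
  let N := ((positivePart 𝔭).comap ι).map (infinitesimalActionHom ρ)
  obtain ⟨k, hk⟩ := 𝒲.exists_pow_map_positivePart_eq_bot h𝔭 ι hP.lieInclusion_injective hP𝔭
    (infinitesimalActionHom ρ) (fun x y z hz => by
      have : z = ⁅x, y⁆ := hP.lieInclusion_injective (by rw [hP.lieInclusion_lie]; exact hz)
      rw [this]
      exact infinitesimalAction_lie hρ x y)
  have hAd : ∀ (p : P) (Y : GroupLieAlgebra (𝓡 r) P),
      lieInclusion (n := n) P Y ∈ positivePart 𝔭 →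
      lieInclusion (n := n) P (adjoint p Y) ∈ positivePart 𝔭 := by
    intro p Y hY
    rw [hP.lieInclusion_adjoint]
    refine h𝔭.map_positivePart_le (adjointEquiv (p : G)) (fun x hx => ?_) hY
    obtain ⟨y, rfl⟩ := (hP𝔭 x).1 hx
    exact (hP𝔭 _).2 ⟨adjoint p⁻¹ y, hP.lieInclusion_adjoint p⁻¹ y⟩
  let ρ' : Representation ℝ P V :=
    (ContinuousLinearMap.toLinearMapRingHom : (V →L[ℝ] V) →+* (V →ₗ[ℝ] V)).toMonoidHom.comp ρ
  have hred : ComplementedLattice (Subrepresentation ρ') := hρred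
  -- NV is P-invariant because Ad(p) preserves 𝔭₊, so that ρ(p) Y v = (Ad(p) Y) ρ(p) v is again in
  -- NV. Its invariant complement is what nilpotency is played against.
  let U : Subrepresentation ρ' :=
    { toSubmodule := Submodule.span ℝ {x | ∃ z ∈ N, ∃ v, z v = x}
      apply_mem_toSubmodule := by
        intro p v hv
        have hle : Submodule.span ℝ {x | ∃ z ∈ N, ∃ v, z v = x} ≤
            (Submodule.span ℝ {x | ∃ z ∈ N, ∃ v, z v = x}).comap (ρ' p) := by
          rw [Submodule.span_le]
          rintro _ ⟨_, ⟨Y, hY, rfl⟩, v, rfl⟩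
          refine Submodule.subset_span ⟨_, ⟨adjoint p Y, hAd p Y hY, rfl⟩, ρ p v, ?_⟩
          refine (infinitesimalAction_conj hρ p (adjoint p Y) v).trans ?_
          rw [← adjoint_mul, inv_mul_cancel, adjoint_one]
          rfl
        exact hle hv }
  obtain ⟨W, hW⟩ := hred.exists_isCompl U
  have hUW : IsCompl U.toSubmodule W.toSubmodule :=
    ⟨disjoint_iff.2 (congrArg Subrepresentation.toSubmodule hW.inf_eq_bot),
      codisjoint_iff.2 (congrArg Subrepresentation.toSubmodule hW.sup_eq_top)⟩
  ext v
  refine apply_eq_zero_of_pow_eq_bot_of_isCompl hk hUW ?_ ⟨Y, hY, rfl⟩ v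
  rintro _ ⟨Y, -, rfl⟩ w hw
  exact infinitesimalAction_mem_of_isCompl hρ hUW
    (fun p w hw => W.apply_mem_toSubmodule p hw) Y hw

end NilradicalAction

end ParabolicGeometry
end

noncomputable section

/-! ### Constant vector fields of a Cartan geometry -/

/-- In finite dimensions an operator is a sum of coordinate functionals times its values on a basis;
this reduces smoothness of ω in a trivialization to its values on vector fields. -/
theorem contMDiffAt_clm_of_forall_apply {E : Type*} [NormedAddCommGroup E] [NormedSpace ℝ E]
    {H : Type*} [TopologicalSpace H] {I : ModelWithCorners ℝ E H}
    {N : Type*} [TopologicalSpace N] [ChartedSpace H N]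
    {F F' : Type*} [NormedAddCommGroup F] [NormedSpace ℝ F] [FiniteDimensional ℝ F]
    [NormedAddCommGroup F'] [NormedSpace ℝ F'] {k : ℕ∞ω} {T : N → F →L[ℝ] F'} {x : N}
    (hT : ∀ w, ContMDiffAt I 𝓘(ℝ, F') k (fun y => T y w) x) :
    ContMDiffAt I 𝓘(ℝ, F →L[ℝ] F') k T x := by
  let b := Module.finBasis ℝ F
  have h1 : T = fun y => ∑ i, ContinuousLinearMap.smulRightL ℝ F F'
      (LinearMap.toContinuousLinearMap (b.coord i)) (T y (b i)) := by
    funext y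
    ext w
    conv_lhs => rw [← b.sum_repr w, map_sum]
    rw [sum_apply]
    refine Finset.sum_congr rfl fun i _ => ?_
    rw [map_smul]
    rfl
  rw [h1]
  refine ContMDiffAt.sum fun i _ => ?_
  exact (ContinuousLinearMap.contMDiff _).contMDiffAt.comp x (hT (b i))

namespace ParabolicGeometry

namespace CartanGeometry

variable {n r m : ℕ}
  {G : Type*} [TopologicalSpace G] [ChartedSpace (EuclideanSpace ℝ (Fin n)) G] [Group G]
  {P : Subgroup G} [ChartedSpace (EuclideanSpace ℝ (Fin r)) P]
  {B : Type*} [TopologicalSpace B] [ChartedSpace (EuclideanSpace ℝ (Fin n)) B]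
  [IsManifold (𝓡 n) ∞ B]
  {M : Type*} [TopologicalSpace M] [ChartedSpace (EuclideanSpace ℝ (Fin m)) M]
  (𝒢 : CartanGeometry (n := n) (r := r) (m := m) P B M)

theorem conn_constField (X : GroupLieAlgebra (𝓡 n) G) (b : B) :
    𝒢.conn b (𝒢.constField X b) = X := (𝒢.conn b).apply_symm_apply X

theorem constField_conn (b : B) (v : TangentSpace (𝓡 n) b) :
    𝒢.constField (𝒢.conn b v) b = v := (𝒢.conn b).symm_apply_apply v

theorem contMDiff_conn_apply {k : ℕ∞ω} (hk : k ≤ ∞) {W : ∀ b : B, TangentSpace (𝓡 n) b} {b : B}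
    (hW : ContMDiffAt (𝓡 n) (𝓡 n).tangent k (fun b => (⟨b, W b⟩ : TangentBundle (𝓡 n) B)) b) :
    ContMDiffAt (𝓡 n) 𝓘(ℝ, EuclideanSpace ℝ (Fin n)) k
      (fun b => lieCoord (𝒢.conn b (W b))) b :=
  ContMDiffAt.comp b (I' := (𝓡 n).tangent)
    (g := fun v : TangentBundle (𝓡 n) B => lieCoord (𝒢.conn v.1 v.2))
    ((𝒢.contMDiff_conn.of_le hk).contMDiffAt) hW

/-- In a local trivialization of the tangent bundle ω is a smooth family of invertible operators,
and inversion of operators is smooth. -/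
theorem contMDiff_constField (X : GroupLieAlgebra (𝓡 n) G) :
    ContMDiff (𝓡 n) (𝓡 n).tangent ∞
      (fun b => (⟨b, 𝒢.constField X b⟩ : TangentBundle (𝓡 n) B)) := by
  intro b₀
  let E := EuclideanSpace ℝ (Fin n)
  let e := trivializationAt E (TangentSpace (𝓡 n) : B → Type _) b₀
  have hb₀ : b₀ ∈ e.baseSet := FiberBundle.mem_baseSet_trivializationAt' b₀
  have hb : ∀ᶠ b in nhds b₀, b ∈ e.baseSet := e.open_baseSet.mem_nhds hb₀
  let T : B → E →L[ℝ] E := fun b =>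
    ((lieCoord (G := G) (n := n)).toContinuousLinearMap.comp
      (𝒢.conn b).toContinuousLinearMap).comp (e.symmL ℝ b)
  have hT : ContMDiffAt (𝓡 n) 𝓘(ℝ, E →L[ℝ] E) ∞ T b₀ := by
    refine contMDiffAt_clm_of_forall_apply fun w => ?_
    refine 𝒢.contMDiff_conn_apply le_rfl (W := fun b => e.symmL ℝ b w) ?_
    refine (Bundle.contMDiffAt_section b₀).2 ?_
    refine (contMDiffAt_const (c := w)).congr_of_eventuallyEq ?_
    filter_upwards [hb] with b hb
    have h0 : e.symmL ℝ b w = e.symm b w := e.symmL_apply hb w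
    have h1 := congrArg Prod.snd (e.apply_mk_symm hb w)
    rw [← h0] at h1
    exact h1
  let S : ∀ b, b ∈ e.baseSet → E ≃L[ℝ] E := fun b hb =>
    ((e.continuousLinearEquivAt ℝ b hb).symm.trans (𝒢.conn b)).trans lieCoord
  have hTS : ∀ b (hb : b ∈ e.baseSet), T b = S b hb := fun b hb => by
    ext1 w
    exact congrArg (fun v => lieCoord (𝒢.conn b v)) (e.symmL_apply hb w)
  have h1 : ContMDiffAt (𝓡 n) 𝓘(ℝ, E →L[ℝ] E) ∞ (fun b => (T b).inverse) b₀ := by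
    have := contDiffAt_map_inverse (n := ∞) (S b₀ hb₀)
    exact ContMDiffAt.comp b₀ (I' := 𝓘(ℝ, E →L[ℝ] E)) (g := ContinuousLinearMap.inverse)
      (by rw [hTS b₀ hb₀]; exact this.contMDiffAt) hT
  have h2 : ContMDiffAt (𝓡 n) 𝓘(ℝ, E) ∞ (fun b => (T b).inverse (lieCoord X)) b₀ :=
    h1.clm_apply contMDiffAt_const
  refine (Bundle.contMDiffAt_section b₀).2 (h2.congr_of_eventuallyEq ?_)
  filter_upwards [hb] with b hb
  rw [hTS b hb, ContinuousLinearMap.inverse_equiv]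
  rfl

theorem mdifferentiableAt_constField (X : GroupLieAlgebra (𝓡 n) G) (b : B) :
    MDifferentiableAt (𝓡 n) (𝓡 n).tangent
      (fun b => (⟨b, 𝒢.constField X b⟩ : TangentBundle (𝓡 n) B)) b :=
  (𝒢.contMDiff_constField X).mdifferentiable (by simp) b

end CartanGeometry
end ParabolicGeometry
end

noncomputable section

/-! ### Brackets of constant vector fields -/

open VectorField in
theorem mlieBracket_sum_smul_right {E : Type*} [NormedAddCommGroup E] [NormedSpace ℝ E]
    [CompleteSpace E] {H : Type*} [TopologicalSpace H] {I : ModelWithCorners ℝ E H}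
    {N : Type*} [TopologicalSpace N] [ChartedSpace H N] [IsManifold I 2 N]
    {ι : Type*} (s : Finset ι) {f : ι → N → ℝ} {U : ∀ x : N, TangentSpace I x}
    {W : ι → ∀ x : N, TangentSpace I x} {x : N}
    (hf : ∀ i, MDifferentiableAt I 𝓘(ℝ, ℝ) (f i) x)
    (hW : ∀ i, MDifferentiableAt I I.tangent (fun y => (⟨y, W i y⟩ : TangentBundle I N)) x) :
    mlieBracket I U (fun y => ∑ i ∈ s, f i y • W i y) x =
      ∑ i ∈ s, ((mvfderiv I (f i) x (U x) : ℝ) • W i x + f i x • mlieBracket I U (W i) x) := by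
  classical
  have : IsManifold I 1 N := .of_le one_le_two
  have hfW : ∀ i, MDifferentiableAt I I.tangent
      (fun y => (⟨y, f i y • W i y⟩ : TangentBundle I N)) x := fun i => (hf i).smul_section (hW i)
  induction s using Finset.induction_on with
  | empty =>
    simp only [Finset.sum_empty]
    exact congrFun (mlieBracket_zero_right (I := I) (W := U)) x
  | insert i s hi ih =>
    have h1 : (fun y => ∑ j ∈ insert i s, f j y • W j y) =
        (fun y => f i y • W i y) + fun y => ∑ j ∈ s, f j y • W j y := by
      funext y
      rw [Finset.sum_insert hi]
      rfl
    rw [h1, Finset.sum_insert hi, ← ih]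
    refine (mlieBracket_add_right (hfW i) (MDifferentiableAt.sum_section fun j _ => hfW j)).trans ?_
    exact congrArg (· + _) (mlieBracket_smul_right (hf i) (hW i))

namespace ParabolicGeometry

namespace CartanGeometry

open VectorField

variable {n r m : ℕ}
  {G : Type*} [TopologicalSpace G] [ChartedSpace (EuclideanSpace ℝ (Fin n)) G] [Group G]
  {P : Subgroup G} [ChartedSpace (EuclideanSpace ℝ (Fin r)) P]
  {B : Type*} [TopologicalSpace B] [ChartedSpace (EuclideanSpace ℝ (Fin n)) B]
  [IsManifold (𝓡 n) ∞ B]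
  {M : Type*} [TopologicalSpace M] [ChartedSpace (EuclideanSpace ℝ (Fin m)) M]
  (𝒢 : CartanGeometry (n := n) (r := r) (m := m) P B M)

theorem constField_lieInclusion (Y : GroupLieAlgebra (𝓡 r) P) (b : B) :
    (𝒢.constField (lieInclusion (n := n) P Y) b : EuclideanSpace ℝ (Fin n)) =
      (mfderiv (𝓡 r) (𝓡 n) (𝒢.act b) 1 Y : EuclideanSpace ℝ (Fin n)) := by
  have h : ∀ b' : B, b' = b → ∀ v : EuclideanSpace ℝ (Fin n),
      𝒢.conn b' v = lieInclusion (n := n) P Y → 𝒢.conn b v = lieInclusion (n := n) P Y := by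
    rintro _ rfl v hv
    exact hv
  have h1 := h _ (𝒢.act_one b) _ (𝒢.conn_fundamental b Y)
  rw [constField, ← h1]
  exact (𝒢.conn b).symm_apply_apply _

theorem mfderiv_act_constField (X : GroupLieAlgebra (𝓡 n) G) (b : B) (p : P) :
    mfderiv (𝓡 n) (𝓡 n) (fun y => 𝒢.act y p) b (𝒢.constField X b) =
      𝒢.constField (adjoint (p : G)⁻¹ X) (𝒢.act b p) := by
  have h := 𝒢.conn_act b p (𝒢.constField X b)
  rw [conn_constField] at h
  rw [← h]
  exact (constField_conn 𝒢 _ _).symm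

/-- The bracket of a fundamental vector field with a constant vector field. -/
theorem mlieBracket_constField_lieInclusion [LieGroup (𝓡 n) ∞ G] [LieGroup (𝓡 r) ∞ P]
    (hP : IsLieSubgroup (n := n) (r := r) P) (Y : GroupLieAlgebra (𝓡 r) P)
    (X : GroupLieAlgebra (𝓡 n) G) (b : B) :
    mlieBracket (𝓡 n) (𝒢.constField (lieInclusion (n := n) P Y)) (𝒢.constField X) b =
      𝒢.constField ⁅lieInclusion (n := n) P Y, X⁆ b := by
  have : IsManifold (𝓡 n) 2 B := .of_le (n := ∞) ENat.LEInfty.out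
  have : IsManifold (𝓡 r) 2 P := .of_le (n := ∞) ENat.LEInfty.out
  let W : ∀ b : B, EuclideanSpace ℝ (Fin n) →ₗ[ℝ] TangentSpace (𝓡 n) b := fun b =>
    ((lieCoord (G := G) (n := n)).symm.trans (𝒢.conn b).symm).toLinearMap
  obtain ⟨h1, h2⟩ := hP.mvfderiv_adjoint_inv X
  have h := mlieBracket_eq_neg_of_mfderiv_act (I := 𝓡 n) (J := 𝓡 r) (act := 𝒢.act)
    (𝒢.contMDiff_act.of_le ENat.LEInfty.out) (p₀ := 1) 𝒢.act_one (b := b) (Y := Y)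
    (𝒢.mdifferentiableAt_constField _ b) (𝒢.constField_lieInclusion Y) (W := W)
    (fun X => 𝒢.mdifferentiableAt_constField (lieCoord.symm X) b) (X := lieCoord X) h1
    (by rw [OneMemClass.coe_one, inv_one, adjoint_one])
    (fun p => 𝒢.mfderiv_act_constField X b p)
  refine h.trans ?_
  have h3 := congrArg (fun v => -W b v) (h2 Y)
  refine h3.trans ?_
  change -(𝒢.conn b).symm (-⁅lieInclusion (n := n) P Y, X⁆) = _
  rw [map_neg, neg_neg]
  rfl

/-- The bilinear map `(X, Y) ↦ ω([X̃, Ỹ])` at the point `b`. -/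
def fieldBracket (X : GroupLieAlgebra (𝓡 n) G) (b : B) :
    EuclideanSpace ℝ (Fin n) →L[ℝ] EuclideanSpace ℝ (Fin n) :=
  haveI : IsManifold (𝓡 n) 2 B := .of_le (n := ∞) ENat.LEInfty.out
  LinearMap.toContinuousLinearMap
  { toFun := fun y =>
      lieCoord (𝒢.conn b (mlieBracket (𝓡 n) (𝒢.constField X) (𝒢.constField (lieCoord.symm y)) b))
    map_add' := fun y z => by
      have h := mlieBracket_add_right (V := 𝒢.constField X)
        (𝒢.mdifferentiableAt_constField (lieCoord.symm y) b)
        (𝒢.mdifferentiableAt_constField (lieCoord.symm z) b)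
      have h' : 𝒢.constField (lieCoord.symm (y + z)) =
        𝒢.constField (lieCoord.symm y) + 𝒢.constField (lieCoord.symm z) :=
        funext fun b => (𝒢.conn b).symm.map_add _ _
      rw [h', h, map_add, map_add]
    map_smul' := fun a y => by
      have h := mlieBracket_const_smul_right (V := 𝒢.constField X) (c := a)
        (𝒢.mdifferentiableAt_constField (lieCoord.symm y) b)
      have h' : 𝒢.constField (lieCoord.symm (a • y)) = a • 𝒢.constField (lieCoord.symm y) :=
        funext fun b => (𝒢.conn b).symm.map_smul _ _
      rw [h', h, map_smul, map_smul]
      rfl }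

theorem fieldBracket_lieCoord (X Y : GroupLieAlgebra (𝓡 n) G) (b : B) :
    𝒢.fieldBracket X b (lieCoord Y) =
      lieCoord (𝒢.conn b (mlieBracket (𝓡 n) (𝒢.constField X) (𝒢.constField Y) b)) := rfl

/-- Together with the next lemma this determines ω([X̃, Ỹ]) for Y in the span of 𝔭 and X, the only
values needed along the flow line; curvature never enters. -/
theorem fieldBracket_self (X : GroupLieAlgebra (𝓡 n) G) (b : B) :
    𝒢.fieldBracket X b (lieCoord X) = 0 := by
  rw [fieldBracket_lieCoord, mlieBracket_self, Pi.zero_apply, map_zero, map_zero]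

theorem fieldBracket_lieInclusion [LieGroup (𝓡 n) ∞ G] [LieGroup (𝓡 r) ∞ P]
    (hP : IsLieSubgroup (n := n) (r := r) P) (Y : GroupLieAlgebra (𝓡 r) P)
    (X : GroupLieAlgebra (𝓡 n) G) (b : B) :
    𝒢.fieldBracket X b (lieCoord (lieInclusion (n := n) P Y)) = lieCoord ⁅X, lieInclusion (n := n) P Y⁆ := by
  have h : mlieBracket (𝓡 n) (𝒢.constField X) (𝒢.constField (lieInclusion (n := n) P Y)) b =
      -𝒢.constField ⁅lieInclusion (n := n) P Y, X⁆ b :=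
    mlieBracket_swap_apply.trans (congrArg (- ·) (𝒢.mlieBracket_constField_lieInclusion hP Y X b))
  rw [fieldBracket_lieCoord, h, map_neg, conn_constField, lie_skew]

/-- Supplies the continuous coefficients for the uniqueness theorem for linear differential
equations. -/
theorem continuous_fieldBracket (X : GroupLieAlgebra (𝓡 n) G) :
    Continuous (𝒢.fieldBracket X) := by
  refine continuous_clm_apply.2 fun y => continuous_iff_continuousAt.2 fun b => ?_
  have : IsManifold (𝓡 n) (((2 : ℕ∞) : ℕ∞ω) + 1) B := .of_le (n := ∞) (by
    norm_num; exact ENat.LEInfty.out)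
  have h : ContMDiff (𝓡 n) (𝓡 n).tangent (1 : ℕ∞) (fun b => (⟨b, mlieBracket (𝓡 n)
      (𝒢.constField X) (𝒢.constField (lieCoord.symm y)) b⟩ : TangentBundle (𝓡 n) B)) :=
    ContDiff.mlieBracket_vectorField (n := 2)
      ((𝒢.contMDiff_constField X).of_le ENat.LEInfty.out)
      ((𝒢.contMDiff_constField _).of_le ENat.LEInfty.out)
      (by rw [minSmoothness_of_isRCLikeNormedField]; norm_num)
  exact (𝒢.contMDiff_conn_apply ENat.LEInfty.out h.contMDiffAt).continuousAt

/-- A vector field that commutes with the constant vector field `X̃` satisfies a linear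
differential equation along the flow lines of `X̃`. -/
theorem mvfderiv_conn_of_mlieBracket_eq_zero {η : ∀ b : B, TangentSpace (𝓡 n) b}
    (hη : ContMDiff (𝓡 n) (𝓡 n).tangent ∞ (fun b => (⟨b, η b⟩ : TangentBundle (𝓡 n) B)))
    {X : GroupLieAlgebra (𝓡 n) G} {b : B}
    (hXη : mlieBracket (𝓡 n) (𝒢.constField X) η b = 0) :
    mvfderiv (𝓡 n) (fun b => lieCoord (𝒢.conn b (η b))) b (𝒢.constField X b) =
      -𝒢.fieldBracket X b (lieCoord (𝒢.conn b (η b))) := by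
  have : IsManifold (𝓡 n) 2 B := .of_le (n := ∞) ENat.LEInfty.out
  set y : B → EuclideanSpace ℝ (Fin n) := fun b => lieCoord (𝒢.conn b (η b)) with hy
  have hyd : MDifferentiableAt (𝓡 n) 𝓘(ℝ, EuclideanSpace ℝ (Fin n)) y b :=
    (𝒢.contMDiff_conn_apply le_rfl (hη b)).mdifferentiableAt (by simp)
  -- Writing η = Σ yᵢ ẽᵢ in a frame of constant fields, the vanishing of [X̃, η] reads Σ (X̃ yᵢ) ẽᵢ
  -- + Σ yᵢ [X̃, ẽᵢ] = 0.
  let e : Fin n → EuclideanSpace ℝ (Fin n) := fun i => EuclideanSpace.single i 1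
  have he : ∀ v : EuclideanSpace ℝ (Fin n), ∑ i, v i • e i = v := fun v => by
    ext j
    simp [e, Pi.single_apply]
  have hf : ∀ i, MDifferentiableAt (𝓡 n) 𝓘(ℝ, ℝ) (fun b => y b i) b ∧
      ∀ w : EuclideanSpace ℝ (Fin n), mvfderiv (𝓡 n) (fun b => y b i) b w = mvfderiv (𝓡 n) y b w i :=
    fun i => mvfderiv_clm_comp (J := 𝓡 n) (EuclideanSpace.proj i : _ →L[ℝ] ℝ) hyd
  have hη' : η = fun b => ∑ i, y b i • 𝒢.constField (lieCoord.symm (e i)) b := by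
    funext b
    have h1 : η b = (𝒢.conn b).symm (lieCoord.symm (y b)) :=
      ((𝒢.conn b).symm_apply_apply (η b)).symm
    conv_lhs => rw [h1, ← he (y b), map_sum, map_sum]
    refine Finset.sum_congr rfl fun i _ => ?_
    rw [map_smul, map_smul]
    rfl
  rw [hη', mlieBracket_sum_smul_right Finset.univ (fun i => (hf i).1)
    (fun i => 𝒢.mdifferentiableAt_constField _ b)] at hXη
  have h2 := congrArg (fun v => lieCoord (𝒢.conn b v)) hXη
  simp only [map_sum, map_add, map_smul, map_zero, conn_constField] at h2
  rw [Finset.sum_add_distrib] at h2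
  have h3 : ∑ i, (mvfderiv (𝓡 n) (fun b => y b i) b (𝒢.constField X b) : ℝ) •
      lieCoord (G := G) (lieCoord.symm (e i)) =
      mvfderiv (𝓡 n) y b (𝒢.constField X b) := by
    refine Eq.trans ?_ (he _)
    exact Finset.sum_congr rfl fun i _ => congrArg (· • e i) ((hf i).2 _)
  have h4 : ∑ i, y b i • lieCoord (𝒢.conn b (mlieBracket (𝓡 n) (𝒢.constField X)
      (𝒢.constField (lieCoord.symm (e i))) b)) = 𝒢.fieldBracket X b (y b) := by
    conv_rhs => rw [← he (y b), map_sum]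
    refine Finset.sum_congr rfl fun i _ => ?_
    rw [map_smul]
    rfl
  rw [h3, h4] at h2
  exact eq_neg_of_add_eq_zero_left h2

/-- Since ω(X̃) is constant, L_η ω evaluated on X̃ is just -ω([η, X̃]), and ω is injective. -/
theorem IsInfinitesimalAutomorphism.mlieBracket_constField
    {η : ∀ b : B, TangentSpace (𝓡 n) b} (hη : 𝒢.IsInfinitesimalAutomorphism η)
    (X : GroupLieAlgebra (𝓡 n) G) (b : B) :
    mlieBracket (𝓡 n) (𝒢.constField X) η b = 0 := by
  have h := hη.2.2 _ (𝒢.contMDiff_constField X) b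
  have h1 : (fun b' => lieCoord (𝒢.conn b' (𝒢.constField X b'))) =
      fun _ : B => lieCoord X := funext fun b' => by rw [conn_constField]
  have h2 : mvfderiv (𝓡 n) (fun b' => lieCoord (𝒢.conn b' (𝒢.constField X b'))) b (η b) = 0 := by
    rw [h1, mvfderiv_const]
    rfl
  have h3 : lieCoord (𝒢.conn b (mlieBracket (𝓡 n) η (𝒢.constField X) b)) = 0 :=
    ((sub_eq_zero.1 h).symm).trans h2
  have h4 : mlieBracket (𝓡 n) η (𝒢.constField X) b = 0 :=
    (𝒢.conn b).injective (lieCoord.injective (h3.trans (by rw [map_zero, map_zero])))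
  rw [mlieBracket_swap_apply, h4, neg_zero]

end CartanGeometry
end ParabolicGeometry
end

noncomputable section

/-! ### Functions along integral curves -/

section IntegralCurves

open Set Filter Topology

variable {E : Type*} [NormedAddCommGroup E] [NormedSpace ℝ E]
  {H : Type*} [TopologicalSpace H] {I : ModelWithCorners ℝ E H}
  {N : Type*} [TopologicalSpace N] [ChartedSpace H N]
  {F : Type*} [NormedAddCommGroup F] [NormedSpace ℝ F]

/-- Uniqueness of solutions of linear differential equations on an open interval. -/
theorem eqOn_of_hasDerivAt_clm_apply {L : ℝ → F →L[ℝ] F} {J : Set ℝ} (hJo : IsOpen J)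
    (hJ : J.OrdConnected) {t₀ : ℝ} (h₀ : t₀ ∈ J) (hL : ContinuousOn L J) {f g : ℝ → F}
    (hf : ∀ u ∈ J, HasDerivAt f (L u (f u)) u) (hg : ∀ u ∈ J, HasDerivAt g (L u (g u)) u)
    (hfg : f t₀ = g t₀) : EqOn f g J := by
  intro u hu
  have hmin : min t₀ u ∈ J := by rcases min_choice t₀ u with h | h <;> rwa [h]
  have hmax : max t₀ u ∈ J := by rcases max_choice t₀ u with h | h <;> rwa [h]
  -- Choose [a, b] ⊆ J with t₀ and u in its interior: on this compact interval the operators are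
  -- bounded, which gives a uniform Lipschitz constant.
  obtain ⟨a', _, ⟨ha1, _⟩, ha2⟩ := mem_nhds_iff_exists_Ioo_subset.1 (hJo.mem_nhds hmin)
  obtain ⟨_, b', ⟨_, hb1⟩, hb2⟩ := mem_nhds_iff_exists_Ioo_subset.1 (hJo.mem_nhds hmax)
  obtain ⟨a, haa, ha⟩ := exists_between ha1
  obtain ⟨b, hb, hbb⟩ := exists_between hb1
  have haJ : a ∈ J := ha2 ⟨haa, by linarith⟩
  have hbJ : b ∈ J := hb2 ⟨by linarith, hbb⟩
  have hsub : Icc a b ⊆ J := hJ.out haJ hbJ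
  obtain ⟨C, hC⟩ := isCompact_Icc.exists_bound_of_continuousOn (hL.mono hsub)
  have hsub' : Ioo a b ⊆ J := Ioo_subset_Icc_self.trans hsub
  refine ODE_solution_unique_of_mem_Ioo (v := fun u => L u) (s := fun _ => univ)
    (K := Real.toNNReal C) (a := a) (b := b) (t₀ := t₀) (fun t ht => ?_)
    ⟨ha.trans_le (min_le_left _ _), (le_max_left _ _).trans_lt hb⟩
    (fun t ht => ⟨hf t (hsub' ht), mem_univ _⟩) (fun t ht => ⟨hg t (hsub' ht), mem_univ _⟩) hfg
    ⟨ha.trans_le (min_le_right _ _), (le_max_right _ _).trans_lt hb⟩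
  have h1 : ‖L t‖₊ ≤ Real.toNNReal C := by
    rw [← NNReal.coe_le_coe, coe_nnnorm]
    exact (hC t (Ioo_subset_Icc_self ht)).trans (Real.le_coe_toNNReal C)
  exact ((L t).lipschitz.weaken h1).lipschitzOnWith

theorem IsMIntegralCurveOn.hasDerivAt_comp {v : ∀ x : N, TangentSpace I x} {c : ℝ → N} {J : Set ℝ}
    (hc : IsMIntegralCurveOn c v J) (hJ : IsOpen J) {u : ℝ} (hu : u ∈ J) {g : N → F}
    (hg : MDifferentiableAt I 𝓘(ℝ, F) g (c u)) :
    HasDerivAt (fun t => g (c t)) (mvfderiv I g (c u) (v (c u))) u := by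
  have h1 := (hc.isMIntegralCurveAt (hJ.mem_nhds hu)).hasMFDerivAt
  let T : E →L[ℝ] F := mvfderiv I g (c u)
  let w : E := v (c u)
  have h2 : HasFDerivAt (fun t => g (c t)) (T.comp ((1 : ℝ →L[ℝ] ℝ).smulRight w)) u :=
    (HasMFDerivAt.comp (I' := I) u hg.hasMFDerivAt h1).hasFDerivAt
  refine h2.hasDerivAt.congr_deriv ?_
  change T ((1 : ℝ) • w) = T w
  rw [one_smul]

theorem contMDiff_mvfderiv_apply [IsManifold I ∞ N] {v : ∀ x : N, TangentSpace I x}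
    (hv : ContMDiff I I.tangent ∞ (fun x => (⟨x, v x⟩ : TangentBundle I N))) {g : N → F}
    (hg : ContMDiff I 𝓘(ℝ, F) ∞ g) :
    ContMDiff I 𝓘(ℝ, F) ∞ (fun x => mvfderiv I g x (v x)) := by
  have : IsManifold I 1 N := .of_le (n := ∞) ENat.LEInfty.out
  have h1 := (hg.contMDiff_tangentMap (m := ∞) (by simp)).comp hv
  exact (contMDiff_snd_tangentBundle_modelSpace F 𝓘(ℝ, F)).comp h1

/-- Smooth functions are smooth along the integral curves of a smooth vector field. -/
theorem IsMIntegralCurveOn.contDiffOn_comp [IsManifold I ∞ N] {v : ∀ x : N, TangentSpace I x}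
    (hv : ContMDiff I I.tangent ∞ (fun x => (⟨x, v x⟩ : TangentBundle I N)))
    {c : ℝ → N} {J : Set ℝ} (hc : IsMIntegralCurveOn c v J) (hJ : IsOpen J) {g : N → F}
    (hg : ContMDiff I 𝓘(ℝ, F) ∞ g) : ContDiffOn ℝ ∞ (fun t => g (c t)) J := by
  refine contDiffOn_infty.2 fun k => ?_
  induction k generalizing g with
  | zero =>
    exact contDiffOn_zero.2 fun u hu =>
      (hc.hasDerivAt_comp hJ hu (hg.mdifferentiable (by simp) _)).continuousAt.continuousWithinAt
  | succ k ih =>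
    have hd : ∀ u ∈ J, HasDerivAt (fun t => g (c t)) (mvfderiv I g (c u) (v (c u))) u :=
      fun u hu => hc.hasDerivAt_comp hJ hu (hg.mdifferentiable (by simp) _)
    have h := (contDiffOn_succ_iff_deriv_of_isOpen (n := (k : ℕ∞ω)) (f := fun t => g (c t)) hJ).2
      ⟨fun u hu => (hd u hu).differentiableAt.differentiableWithinAt, by simp,
        (ih (contMDiff_mvfderiv_apply hv hg)).congr fun u hu => (hd u hu).deriv⟩
    exact_mod_cast h

end IntegralCurves

namespace ParabolicGeometry

/-- Some integral curve of η passes through b, and τ is constant along it. -/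
theorem IsFlowInvariant.mvfderiv_eq_zero {n : ℕ} {B : Type*} [TopologicalSpace B]
    [ChartedSpace (EuclideanSpace ℝ (Fin n)) B] [IsManifold (𝓡 n) ∞ B]
    {V : Type*} [NormedAddCommGroup V] [NormedSpace ℝ V]
    {η : ∀ b : B, TangentSpace (𝓡 n) b} {τ : B → V} (hτη : IsFlowInvariant η τ)
    (hη : ContMDiff (𝓡 n) (𝓡 n).tangent ∞ (fun b => (⟨b, η b⟩ : TangentBundle (𝓡 n) B)))
    {b : B} (hτ : MDifferentiableAt (𝓡 n) 𝓘(ℝ, V) τ b) :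
    mvfderiv (𝓡 n) τ b (η b) = 0 := by
  have : IsManifold (𝓡 n) 1 B := .of_le (n := ∞) ENat.LEInfty.out
  obtain ⟨c, rfl, hc⟩ := exists_isMIntegralCurveAt_of_contMDiffAt_boundaryless (t₀ := 0)
    ((hη.of_le ENat.LEInfty.out).contMDiffAt (x := b))
  obtain ⟨ε, hε, hc⟩ := isMIntegralCurveAt_iff'.1 hc
  rw [Real.ball_eq_Ioo] at hc
  have h0 : (0 : ℝ) ∈ Set.Ioo (0 - ε) (0 + ε) := ⟨by linarith, by linarith⟩
  have h1 := hc.hasDerivAt_comp isOpen_Ioo h0 hτ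
  refine h1.unique ((hasDerivAt_const (0 : ℝ) (τ (c 0))).congr_of_eventuallyEq ?_)
  filter_upwards [Ioo_mem_nhds h0.1 h0.2] with t ht
  exact hτη c _ _ hc t ht 0 h0

/-! ### Equivariant functions and infinitesimal automorphisms along flow lines -/

namespace CartanGeometry

variable {n r m : ℕ}
  {G : Type*} [TopologicalSpace G] [ChartedSpace (EuclideanSpace ℝ (Fin n)) G] [Group G]
  {P : Subgroup G} [ChartedSpace (EuclideanSpace ℝ (Fin r)) P]
  {B : Type*} [TopologicalSpace B] [ChartedSpace (EuclideanSpace ℝ (Fin n)) B]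
  [IsManifold (𝓡 n) ∞ B]
  {M : Type*} [TopologicalSpace M] [ChartedSpace (EuclideanSpace ℝ (Fin m)) M]
  (𝒢 : CartanGeometry (n := n) (r := r) (m := m) P B M)

/-- An equivariant function is differentiated along fundamental vector fields by means of the
infinitesimal action. -/
theorem mvfderiv_constField_lieInclusion {V : Type*} [NormedAddCommGroup V] [NormedSpace ℝ V]
    {ρ : P →* (V →L[ℝ] V)} (hρ : ContMDiff (𝓡 r) 𝓘(ℝ, V →L[ℝ] V) ∞ (fun p : P => ρ p))
    {τ : B → V} (hτ : ContMDiff (𝓡 n) 𝓘(ℝ, V) ∞ τ)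
    (hτP : ∀ (b : B) (p : P), τ (𝒢.act b p) = ρ p⁻¹ (τ b)) (Y : GroupLieAlgebra (𝓡 r) P) (b : B) :
    mvfderiv (𝓡 n) τ b (𝒢.constField (lieInclusion (n := n) P Y) b) =
      -infinitesimalAction ρ Y (τ b) := by
  have hact : MDifferentiableAt (𝓡 r) (𝓡 n) (𝒢.act b) 1 :=
    MDifferentiableAt.comp (I' := (𝓡 n).prod (𝓡 r)) (g := fun z : B × P => 𝒢.act z.1 z.2)
      (f := fun z : P => (b, z)) 1 (𝒢.contMDiff_act.mdifferentiable (by simp) _)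
      (mdifferentiableAt_const.prodMk mdifferentiableAt_id)
  have hτ' : ∀ b, MDifferentiableAt (𝓡 n) 𝓘(ℝ, V) τ b := hτ.mdifferentiable (by simp)
  have hτa : MDifferentiableAt (𝓡 r) 𝓘(ℝ, V) (fun p => τ (𝒢.act b p)) 1 :=
    MDifferentiableAt.comp (I' := 𝓡 n) (g := τ) (f := 𝒢.act b) 1 (hτ' _) hact
  -- The function p ↦ ρ(p) τ(bp) is constant; its derivative at 1 is Yτ(b) plus the derivative of τ
  -- along the fundamental field.
  have h1 := (mvfderiv_clm_apply (J := 𝓡 r) (hρ.mdifferentiable (by simp) 1) hτa).2 Y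
  have h2 : (fun p : P => ρ p (τ (𝒢.act b p))) = fun _ => τ b := by
    funext p
    rw [hτP, ← mul_apply_eq_comp, ← map_mul, mul_inv_cancel, map_one]
    rfl
  have h3 : mvfderiv (𝓡 r) (fun p : P => τ (𝒢.act b p)) 1 Y =
      mvfderiv (𝓡 n) τ b (𝒢.constField (lieInclusion (n := n) P Y) b) := by
    have h4 : ∀ b' : B, b' = b → ∀ w : EuclideanSpace ℝ (Fin n),
        mvfderiv (𝓡 n) τ b' w = mvfderiv (𝓡 n) τ b w := by
      rintro _ rfl w
      rfl
    refine (mvfderiv_comp_eq (I := 𝓡 n) (J := 𝓡 r) (hτ' _) hact Y).trans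
      ((h4 _ (𝒢.act_one b) _).trans ?_)
    exact congrArg (mvfderiv (𝓡 n) τ b) (𝒢.constField_lieInclusion Y b).symm
  rw [h2, mvfderiv_const, h3, 𝒢.act_one, map_one] at h1
  exact eq_neg_of_add_eq_zero_right h1.symm

/-- The values of an infinitesimal automorphism along the flow line of `X̃` through a higher order
zero. -/
theorem IsInfinitesimalAutomorphism.eqOn_constField [LieGroup (𝓡 n) ∞ G] [LieGroup (𝓡 r) ∞ P]
    (hP : IsLieSubgroup (n := n) (r := r) P)
    {η : ∀ b : B, TangentSpace (𝓡 n) b} (hη : 𝒢.IsInfinitesimalAutomorphism η)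
    {Z X : GroupLieAlgebra (𝓡 n) G} {Y A : GroupLieAlgebra (𝓡 r) P}
    (hY : lieInclusion (n := n) P Y = Z) (hA : lieInclusion (n := n) P A = ⁅Z, X⁆)
    (hAX : ⁅⁅Z, X⁆, X⁆ = (-2 : ℝ) • X) {c : ℝ → B} {J : Set ℝ} (hJo : IsOpen J)
    (hJ : J.OrdConnected) (h0 : (0 : ℝ) ∈ J) (hc : IsMIntegralCurveOn c (𝒢.constField X) J)
    (hcZ : 𝒢.conn (c 0) (η (c 0)) = Z) :
    ∀ u ∈ J, η (c u) = 𝒢.constField (Z + u • ⁅Z, X⁆ - u ^ 2 • X) (c u) := by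
  have h1 : Set.EqOn (fun u => lieCoord (𝒢.conn (c u) (η (c u))))
      (fun u => lieCoord (Z + u • ⁅Z, X⁆ - u ^ 2 • X)) J := by
    refine eqOn_of_hasDerivAt_clm_apply (L := fun u => -𝒢.fieldBracket X (c u)) hJo hJ h0
      ((𝒢.continuous_fieldBracket X).comp_continuousOn hc.continuousOn).neg
      (fun u hu => ?_) (fun u hu => ?_) (by simp [hcZ])
    · have h2 := hc.hasDerivAt_comp hJo hu
        ((𝒢.contMDiff_conn_apply le_rfl (hη.1 (c u))).mdifferentiableAt (by simp))
      exact h2.congr_deriv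
        (𝒢.mvfderiv_conn_of_mlieBracket_eq_zero hη.1 (hη.mlieBracket_constField 𝒢 X (c u)))
    · have h2 : HasDerivAt (fun u : ℝ => lieCoord Z + u • lieCoord ⁅Z, X⁆ - u ^ 2 • lieCoord X)
          (lieCoord ⁅Z, X⁆ - (2 * u) • lieCoord X) u := by
        have h3 := (((hasDerivAt_id u).smul_const (lieCoord ⁅Z, X⁆)).const_add
          (lieCoord Z)).sub ((hasDerivAt_pow 2 u).smul_const (lieCoord X))
        refine h3.congr_deriv ?_
        simp
      have h4 : (fun u : ℝ => lieCoord (Z + u • ⁅Z, X⁆ - u ^ 2 • X)) =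
          fun u : ℝ => lieCoord Z + u • lieCoord ⁅Z, X⁆ - u ^ 2 • lieCoord X := by
        funext u
        rw [map_sub, map_add, map_smul, map_smul]
      rw [h4]
      refine h2.congr_deriv ?_
      -- For the explicit curve the right-hand side is -[X, Z] - u[X, A] = A + u[A, X] = A - 2uX,
      -- which is its derivative.
      have h5 := 𝒢.fieldBracket_lieInclusion hP Y X (c u)
      have h6 := 𝒢.fieldBracket_lieInclusion hP A X (c u)
      rw [hY] at h5
      rw [hA, ← lie_skew X ⁅Z, X⁆, hAX] at h6
      rw [neg_apply, map_sub, map_add, map_smul, map_smul, map_sub, map_add, map_smul, map_smul, h5, h6,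
        fieldBracket_self, ← lie_skew X Z, map_neg, map_neg, map_smul]
      module
  intro u hu
  have h2 := lieCoord.injective (h1 hu)
  rw [← h2, constField_conn]

end CartanGeometry
end ParabolicGeometry
end

noncomputable section

/-! ### Invariant sections along exponential curves -/

section EigenComponents

variable {V : Type*} [AddCommGroup V] [Module ℝ V]

/-- The values -k are pairwise distinct, so all other summands lie in other eigenspaces; for k ≥ N
the component is zero, in agreement with `hN`. -/
theorem isEigenComponent_sum {T : Module.End ℝ V} {N : ℕ} {v : ℕ → V}
    (hv : ∀ k : ℕ, v k ∈ T.eigenspace (-(k : ℝ))) (hN : ∀ k, N ≤ k → v k = 0) (k : ℕ) :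
    ParabolicGeometry.IsEigenComponent T (-(k : ℝ)) (∑ j ∈ Finset.range N, v j) (v k) := by
  classical
  refine ⟨hv k, ?_⟩
  have h : ∑ j ∈ Finset.range N, v j - v k = ∑ j ∈ (Finset.range N).erase k, v j := by
    by_cases hk : k ∈ Finset.range N
    · rw [← Finset.add_sum_erase _ _ hk, add_sub_cancel_left]
    · rw [hN k (by simpa using hk), sub_zero, Finset.erase_eq_of_notMem hk]
  rw [h]
  refine Submodule.sum_mem _ fun j hj => ?_
  have hjk : -(j : ℝ) ≠ -(k : ℝ) := fun h =>
    (Finset.mem_erase.1 hj).1 (Nat.cast_injective (neg_injective h))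
  exact (le_iSup₂_of_le (f := fun (ν : ℝ) (_ : ν ≠ -(k : ℝ)) => T.eigenspace ν) _ hjk le_rfl) (hv j)

end EigenComponents

namespace ParabolicGeometry

namespace CartanGeometry

open Set Filter Topology

variable {n r m : ℕ}
  {G : Type*} [TopologicalSpace G] [ChartedSpace (EuclideanSpace ℝ (Fin n)) G] [Group G]
  [LieGroup (𝓡 n) ∞ G]
  {P : Subgroup G} [ChartedSpace (EuclideanSpace ℝ (Fin r)) P] [LieGroup (𝓡 r) ∞ P]
  {B : Type*} [TopologicalSpace B] [ChartedSpace (EuclideanSpace ℝ (Fin n)) B]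
  [IsManifold (𝓡 n) ∞ B]
  {M : Type*} [TopologicalSpace M] [ChartedSpace (EuclideanSpace ℝ (Fin m)) M]
  (𝒢 : CartanGeometry (n := n) (r := r) (m := m) P B M)

omit [LieGroup (𝓡 n) ∞ G] [LieGroup (𝓡 r) ∞ P] in
theorem exists_isMIntegralCurveOn_constField (X : GroupLieAlgebra (𝓡 n) G) (b : B) :
    ∃ (c : ℝ → B) (ε : ℝ), 0 < ε ∧ c 0 = b ∧
      IsMIntegralCurveOn c (𝒢.constField X) (Ioo (-ε) ε) := by
  have : IsManifold (𝓡 n) 1 B := .of_le (n := ∞) ENat.LEInfty.out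
  obtain ⟨c, hcb, hc⟩ := exists_isMIntegralCurveAt_of_contMDiffAt_boundaryless (t₀ := 0)
    (((𝒢.contMDiff_constField X).of_le ENat.LEInfty.out).contMDiffAt (x := b))
  obtain ⟨ε, hε, hc⟩ := isMIntegralCurveAt_iff'.1 hc
  rw [Real.ball_eq_Ioo, zero_sub, zero_add] at hc
  exact ⟨c, ε, hε, hcb, hc⟩

omit [LieGroup (𝓡 n) ∞ G] [LieGroup (𝓡 r) ∞ P] in
-- The value s = 0 escapes the rescaling used for s ≠ 0. The curve chosen for the zero field is
-- constant by uniqueness of integral curves, which needs B Hausdorff; the default value of `exp` is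
-- b as well.
theorem expCurve_zero [T2Space B] (b : B) (X : GroupLieAlgebra (𝓡 n) G) :
    𝒢.expCurve b X 0 = b := by
  have : IsManifold (𝓡 n) 1 B := .of_le (n := ∞) ENat.LEInfty.out
  unfold expCurve exp
  split_ifs with h
  · obtain ⟨h0, t₀, t₁, ht₀, ht₁, hc⟩ := h.choose_spec
    have hz : ∀ b : B, 𝒢.constField ((0 : ℝ) • X) b = 0 := fun b => by
      rw [zero_smul]
      exact (𝒢.conn b).symm.map_zero
    have h1 := isMIntegralCurveOn_Ioo_eqOn_of_contMDiff_boundaryless (t₀ := 0)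
      ⟨ht₀, zero_lt_one.trans ht₁⟩ ((𝒢.contMDiff_constField _).of_le ENat.LEInfty.out) hc
      ((isMIntegralCurve_const (hz b)).isMIntegralCurveOn _) h0
    exact h1 ⟨ht₀.trans zero_lt_one, ht₁⟩
  · rfl

omit [LieGroup (𝓡 n) ∞ G] [LieGroup (𝓡 r) ∞ P] in
/-- For `s ≠ 0` in the domain, the value `exp_b(sX)` lies on an integral curve of `X̃`. -/
theorem exists_expCurve_eq {b : B} {X : GroupLieAlgebra (𝓡 n) G} {s : ℝ}
    (hs : s ∈ 𝒢.expCurveDomain b X) (hs0 : s ≠ 0) :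
    ∃ (c : ℝ → B) (J : Set ℝ), IsOpen J ∧ J.OrdConnected ∧ 0 ∈ J ∧ s ∈ J ∧ c 0 = b ∧
      IsMIntegralCurveOn c (𝒢.constField X) J ∧ 𝒢.expCurve b X s = c s := by
  have h : ∃ c : ℝ → B, 𝒢.IsUnitFlowLine b (s • X) c := hs
  obtain ⟨h0, t₀, t₁, ht₀, ht₁, hc⟩ := h.choose_spec
  have hJ : {t | t * s⁻¹ ∈ Ioo t₀ t₁} = (fun t => t * s⁻¹) ⁻¹' Ioo t₀ t₁ := rfl
  -- Slowing a flow line of the field of sX by s⁻¹ gives a flow line of X̃ and moves time 1 to time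
  -- s.
  refine ⟨h.choose ∘ (· * s⁻¹), {t | t * s⁻¹ ∈ Ioo t₀ t₁}, ?_, ?_, ?_, ?_, ?_, ?_, ?_⟩
  · rw [hJ]
    exact isOpen_Ioo.preimage (continuous_mul_const _)
  · rw [hJ]
    rcases le_total 0 s⁻¹ with hs' | hs'
    · exact ordConnected_Ioo.preimage_mono fun x y hxy => mul_le_mul_of_nonneg_right hxy hs'
    · exact ordConnected_Ioo.preimage_anti fun x y hxy => mul_le_mul_of_nonpos_right hxy hs'
  · simpa using ⟨ht₀, zero_lt_one.trans ht₁⟩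
  · simpa [hs0] using ⟨ht₀.trans zero_lt_one, ht₁⟩
  · simpa using h0
  · have h1 : s⁻¹ • 𝒢.constField (s • X) = 𝒢.constField X := by
      funext y
      change s⁻¹ • (𝒢.conn y).symm (s • X) = _
      rw [map_smul, smul_smul, inv_mul_cancel₀ hs0, one_smul]
      rfl
    have h2 := hc.comp_mul s⁻¹
    rwa [h1] at h2
  · rw [expCurve, exp, dif_pos h, Function.comp_apply, mul_inv_cancel₀ hs0]

/-- Invariant sections are polynomial along the integral curves of `X̃`. -/
theorem exists_eq_sum_of_isMIntegralCurveOn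
    (hP : IsLieSubgroup (n := n) (r := r) P)
    {η : ∀ b : B, TangentSpace (𝓡 n) b} (hη : 𝒢.IsInfinitesimalAutomorphism η)
    {V : Type*} [NormedAddCommGroup V] [NormedSpace ℝ V]
    {ρ : P →* (V →L[ℝ] V)} (hρ : ContMDiff (𝓡 r) 𝓘(ℝ, V →L[ℝ] V) ∞ (fun p : P => ρ p))
    {τ : B → V} (hτ : ContMDiff (𝓡 n) 𝓘(ℝ, V) ∞ τ)
    (hτP : ∀ (b : B) (p : P), τ (𝒢.act b p) = ρ p⁻¹ (τ b)) (hτη : IsFlowInvariant η τ)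
    {Z X : GroupLieAlgebra (𝓡 n) G} {Y A : GroupLieAlgebra (𝓡 r) P}
    (hY : lieInclusion (n := n) P Y = Z) (hρY : infinitesimalAction ρ Y = 0)
    (hA : lieInclusion (n := n) P A = ⁅Z, X⁆)
    (hAX : ⁅⁅Z, X⁆, X⁆ = (-2 : ℝ) • X) {N : ℕ}
    (hN : ‖(mvfderiv (𝓡 r) (fun p : P => ρ p) 1 A : V →L[ℝ] V)‖ < N)
    {c : ℝ → B} {J : Set ℝ} (hJo : IsOpen J)
    (hJ : J.OrdConnected) (h0 : (0 : ℝ) ∈ J) (hc : IsMIntegralCurveOn c (𝒢.constField X) J)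
    (hcZ : 𝒢.conn (c 0) (η (c 0)) = Z) :
    ∃ v : ℕ → V, (∀ k : ℕ, v k ∈ (infinitesimalAction ρ A).eigenspace (-(k : ℝ))) ∧
      (∀ k, N ≤ k → v k = 0) ∧ ∀ u ∈ J, τ (c u) = ∑ k ∈ Finset.range N, u ^ k • v k := by
  let T : V →L[ℝ] V := mvfderiv (𝓡 r) (fun p : P => ρ p) 1 A
  have hsm : ContDiffOn ℝ ∞ (fun u => τ (c u)) J :=
    hc.contDiffOn_comp (𝒢.contMDiff_constField X) hJo hτ
  have hτd : ∀ b, MDifferentiableAt (𝓡 n) 𝓘(ℝ, V) τ b := hτ.mdifferentiable (by simp)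
  have hne : ∀ u ∈ J, u ≠ 0 → u • deriv (fun u => τ (c u)) u = -T (τ (c u)) := by
    intro u hu hu0
    have hd : deriv (fun u => τ (c u)) u = mvfderiv (𝓡 n) τ (c u) (𝒢.constField X (c u)) :=
      (hc.hasDerivAt_comp hJo hu (hτd _)).deriv
    let D : GroupLieAlgebra (𝓡 n) G →ₗ[ℝ] V :=
      (mvfderiv (𝓡 n) τ (c u)).toLinearMap ∘ₗ (𝒢.conn (c u)).symm.toLinearMap
    have hD : ∀ W, D W = mvfderiv (𝓡 n) τ (c u) (𝒢.constField W (c u)) := fun _ => rfl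
    -- The derivative of τ along η, with η expressed by its known values on the curve.
    have h1 : D (Z + u • ⁅Z, X⁆ - u ^ 2 • X) = 0 := by
      rw [hD, ← hη.eqOn_constField 𝒢 hP hY hA hAX hJo hJ h0 hc hcZ u hu]
      exact hτη.mvfderiv_eq_zero hη.1 (hτd _)
    have h2 : D Z = 0 := by
      rw [hD, ← hY, 𝒢.mvfderiv_constField_lieInclusion hρ hτ hτP, hρY, LinearMap.zero_apply,
        neg_zero]
    have h3 : D ⁅Z, X⁆ = -T (τ (c u)) := by
      rw [hD, ← hA, 𝒢.mvfderiv_constField_lieInclusion hρ hτ hτP]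
      rfl
    rw [map_sub, map_add, map_smul, map_smul, h2, h3, zero_add, sub_eq_zero, pow_two,
      mul_smul] at h1
    rw [hd, ← hD]
    -- The relation carries a superfluous factor u, which can be cancelled only away from 0; the
    -- equation at 0 follows afterwards by continuity.
    exact (smul_right_injective V hu0 h1).symm
  have hcd : ContinuousOn (deriv fun u => τ (c u)) J :=
    hsm.continuousOn_deriv_of_isOpen hJo (by simp)
  have heq : ∀ u ∈ J, u • deriv (fun u => τ (c u)) u = -T (τ (c u)) := by
    intro u hu
    by_cases hu0 : u = 0
    · subst hu0
      have h1 : ContinuousAt (fun u => u • deriv (fun u => τ (c u)) u) 0 :=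
        continuousAt_id.smul (hcd.continuousAt (hJo.mem_nhds hu))
      have h2 : ContinuousAt (fun u => -T (τ (c u))) 0 :=
        (T.continuous.continuousAt.comp (hsm.continuousOn.continuousAt (hJo.mem_nhds hu))).neg
      refine tendsto_nhds_unique_of_eventuallyEq
        (h1.tendsto.mono_left nhdsWithin_le_nhds) (h2.tendsto.mono_left nhdsWithin_le_nhds)
        (l := 𝓝[≠] 0) ?_
      filter_upwards [self_mem_nhdsWithin, nhdsWithin_le_nhds (hJo.mem_nhds hu)] with t ht htJ
      exact hne t htJ ht
    · exact hne u hu hu0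
  obtain ⟨v, hv, hv0, hvs⟩ := eulerEquation_exists_polynomial (A := T) hN hJo hJ h0 hsm heq
  exact ⟨v, fun k => Module.End.mem_eigenspace_iff.2 (hv k), hv0, hvs⟩

end CartanGeometry
end ParabolicGeometry
end

/-! ### The polynomial along the whole exponential curve -/

theorem mainTheorem9 {n r m : ℕ}
    {G : Type*} [TopologicalSpace G] [ChartedSpace (EuclideanSpace ℝ (Fin n)) G] [Group G]
    [LieGroup (𝓡 n) ∞ G]
    [LieAlgebra.IsSemisimple ℝ (GroupLieAlgebra (𝓡 n) G)]
    (𝔭 : LieSubalgebra ℝ (GroupLieAlgebra (𝓡 n) G)) (h𝔭 : ParabolicGeometry.IsParabolic 𝔭)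
    (𝒲 : ParabolicGeometry.WeylStructure 𝔭)
    (P : Subgroup G) [ChartedSpace (EuclideanSpace ℝ (Fin r)) P] [LieGroup (𝓡 r) ∞ P]
    (hP : ParabolicGeometry.IsLieSubgroup (n := n) (r := r) P)
    (hP𝔭 : ∀ x : GroupLieAlgebra (𝓡 n) G,
      x ∈ 𝔭 ↔ ∃ Y : GroupLieAlgebra (𝓡 r) P, ParabolicGeometry.lieInclusion (n := n) P Y = x)
    {M : Type*} [TopologicalSpace M] [T2Space M] [ChartedSpace (EuclideanSpace ℝ (Fin m)) M]
    [IsManifold (𝓡 m) ∞ M]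
    {B : Type*} [TopologicalSpace B] [T2Space B] [ChartedSpace (EuclideanSpace ℝ (Fin n)) B]
    [IsManifold (𝓡 n) ∞ B]
    (𝒢 : ParabolicGeometry.CartanGeometry (n := n) (r := r) (m := m) P B M)
    (η : ∀ b : B, TangentSpace (𝓡 n) b) (hη : 𝒢.IsInfinitesimalAutomorphism η)
    (b₀ : B) (Z : GroupLieAlgebra (𝓡 n) G) (hηZ : 𝒢.conn b₀ (η b₀) = Z)
    (hZ : Z ∈ ParabolicGeometry.positivePart 𝔭)
    {V : Type*} [NormedAddCommGroup V] [NormedSpace ℝ V] [FiniteDimensional ℝ V]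
    (ρ : P →* (V →L[ℝ] V)) (hρ : ContMDiff (𝓡 r) 𝓘(ℝ, V →L[ℝ] V) ∞ (fun p : P => ρ p))
    (hρred : ParabolicGeometry.IsCompletelyReducible ρ)
    (τ : B → V) (hτ : ContMDiff (𝓡 n) 𝓘(ℝ, V) ∞ τ)
    (hτP : ∀ (b : B) (p : P), τ (𝒢.act b p) = ρ p⁻¹ (τ b))
    (hτη : ParabolicGeometry.IsFlowInvariant η τ)
    (X : GroupLieAlgebra (𝓡 n) G) (hX : X ∈ ParabolicGeometry.counterpart 𝒲 Z)
    (hA₀ : ⁅Z, X⁆ ∈ 𝒲.grade 0)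
    (A : GroupLieAlgebra (𝓡 r) P) (hA : ParabolicGeometry.lieInclusion (n := n) P A = ⁅Z, X⁆) :
    ∃ v : ℕ →₀ V,
      (∀ k : ℕ, v k ∈
        (ParabolicGeometry.infinitesimalAction ρ A).eigenspace (-(k : ℝ))) ∧
      (∀ k : ℕ, ∀ s ∈ 𝒢.expCurveDomain b₀ X,
        ParabolicGeometry.IsEigenComponent (ParabolicGeometry.infinitesimalAction ρ A)
          (-(k : ℝ)) (τ (𝒢.expCurve b₀ X s)) (s ^ k • v k)) ∧
      ∀ s ∈ 𝒢.expCurveDomain b₀ X,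
        τ (𝒢.expCurve b₀ X s) = v.sum (fun k w => s ^ k • w) := by
  have : IsManifold (𝓡 n) 1 B := .of_le (n := ∞) ENat.LEInfty.out
  obtain ⟨Y, hY⟩ : ∃ Y, ParabolicGeometry.lieInclusion (n := n) P Y = Z := by
    refine (hP𝔭 Z).1 ?_
    obtain ⟨y, -, hy⟩ := hZ
    rw [← hy]
    exact y.2
  have hρY : ParabolicGeometry.infinitesimalAction ρ Y = 0 :=
    ParabolicGeometry.infinitesimalAction_eq_zero_of_mem_positivePart h𝔭 𝒲 hP hP𝔭 hρ hρred
      (by rwa [hY])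
  -- This bound on the number of coefficients depends only on the operator of A, so it serves all
  -- integral curves at once.
  obtain ⟨N, hN⟩ := exists_nat_gt ‖(mvfderiv (𝓡 r) (fun p : P => ρ p) 1 A : V →L[ℝ] V)‖
  have key := fun (c : ℝ → B) (J : Set ℝ) (hJo : IsOpen J) (hJ : J.OrdConnected) (h0 : (0 : ℝ) ∈ J)
      (hcb : c 0 = b₀) (hc : IsMIntegralCurveOn c (𝒢.constField X) J) =>
    𝒢.exists_eq_sum_of_isMIntegralCurveOn hP hη hρ hτ hτP hτη hY hρY hA hX.2.2 hN hJo hJ h0 hc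
      (by rw [hcb, hηZ])
  -- The coefficients are read off from one short curve, so that they do not depend on s.
  obtain ⟨c₀, ε, hε, hc₀b, hc₀⟩ := 𝒢.exists_isMIntegralCurveOn_constField X b₀
  have h0ε : (0 : ℝ) ∈ Set.Ioo (-ε) ε := ⟨by linarith, hε⟩
  obtain ⟨v, hv, hvN, hvs⟩ := key c₀ _ isOpen_Ioo Set.ordConnected_Ioo h0ε hc₀b hc₀
  have hsmul : ∀ {w : ℕ → V}, (∀ k : ℕ, w k ∈
      (ParabolicGeometry.infinitesimalAction ρ A).eigenspace (-(k : ℝ))) →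
      (∀ k, N ≤ k → w k = 0) → ∀ (s : ℝ) (k : ℕ),
      ParabolicGeometry.IsEigenComponent (ParabolicGeometry.infinitesimalAction ρ A)
        (-(k : ℝ)) (∑ j ∈ Finset.range N, s ^ j • w j) (s ^ k • w k) := fun hw hwN s =>
    isEigenComponent_sum (v := fun k => s ^ k • _) (fun k => Submodule.smul_mem _ _ (hw k))
      (fun k hk => by simp only [hwN k hk, smul_zero])
  have hsum : ∀ s ∈ 𝒢.expCurveDomain b₀ X,
      τ (𝒢.expCurve b₀ X s) = ∑ k ∈ Finset.range N, s ^ k • v k := by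
    intro s hs
    by_cases hs0 : s = 0
    · subst hs0
      rw [𝒢.expCurve_zero, ← hc₀b, hvs 0 h0ε]
    · obtain ⟨c, J, hJo, hJ, h0, hsJ, hcb, hc, hcs⟩ := 𝒢.exists_expCurve_eq hs hs0
      obtain ⟨w, hw, hwN, hws⟩ := key c J hJo hJ h0 hcb hc
      -- The curve that reaches s agrees with the reference curve near 0. At a single common time u
      -- ≠ 0, uniqueness of eigencomponents gives uᵏ w_k = uᵏ v_k, hence equal coefficients.
      have hcc : c =ᶠ[nhds 0] c₀ := isMIntegralCurveAt_eventuallyEq_of_contMDiffAt_boundaryless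
        ((𝒢.contMDiff_constField X).of_le ENat.LEInfty.out).contMDiffAt
        (hc.isMIntegralCurveAt (hJo.mem_nhds h0))
        (hc₀.isMIntegralCurveAt (isOpen_Ioo.mem_nhds h0ε)) (hcb.trans hc₀b.symm)
      have h1 : ∀ᶠ u in nhds (0 : ℝ), u ∈ J := hJo.mem_nhds h0
      have h2 : ∀ᶠ u in nhds (0 : ℝ), u ∈ Set.Ioo (-ε) ε := isOpen_Ioo.mem_nhds h0ε
      have h3 : ∀ᶠ u in nhdsWithin (0 : ℝ) {0}ᶜ, u ≠ 0 := self_mem_nhdsWithin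
      obtain ⟨u, ⟨hu, huJ, huε⟩, hu0⟩ :=
        (((hcc.and (h1.and h2)).filter_mono nhdsWithin_le_nhds).and h3).exists
      have hwv : ∀ k, w k = v k := fun k => by
        have h1 := hsmul hw hwN u k
        rw [← hws u huJ, hu, hvs u huε] at h1
        exact smul_right_injective V (pow_ne_zero k hu0) (h1.unique (hsmul hv hvN u k))
      rw [hcs, hws s hsJ]
      exact Finset.sum_congr rfl fun k _ => by rw [hwv]
  classical
  refine ⟨Finsupp.onFinset (Finset.range N) v fun k hk => ?_, hv, fun k s hs => ?_, fun s hs => ?_⟩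
  · by_contra h
    exact hk (hvN k (by simpa using h))
  · rw [hsum s hs]
    exact hsmul hv hvN s k
  · rw [hsum s hs, Finsupp.onFinset_sum _ fun k => smul_zero _]
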